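/- A temporal graph $\mathcal G=(G,\lambda)$ is a finite simple undirected graph $G=(V,E)$ together with a label $\lambda(e)\in\mathbb N$ for every edge $e\in E$. An orientation of $\mathcal G$ is a set $O$ of ordered pairs containing exactly one of $(a,b),(b,a)$ for each edge $ab\in E$ and nothing else. It is a temporal transitive orientation (TTO) if, whenever $(a,b)\in O$ and $(b,c)\in O$ with $\lambda(ab)\le\lambda(bc)$, also $(a,c)\in O$ and $\lambda(ac)\ge\lambda(bc)$. $\mathcal G$ is a T-comparability temporal graph if it admits a TTO. Theorem. There is a (deterministic word-RAM) algorithm which, given a temporal graph $\mathcal G$ with $n$ vertices and $m$ edges as a list of its labelled edges, decides whether $\mathcal G$ is a T-comparability temporal graph and, if the answer is yes, outputs a TTO of $\mathcal G$. It runs in time $$\max\{O(nm),\ \min\{O(kn),\,O(m^2)\}\},$$ where $k$ is the number of monolabel triangles of $\mathcal G$, i.e. of triangles whose three edges carry the same label. Explicitly, there is a constant $C$ such that on every input the algorithm halts after at most $C\cdot(\max\{nm,\min\{kn,m^2\}\}+1)$ unit-cost steps (arithmetic operations, tests, memory accesses), all arithmetic on words of $O(\log(n+\Lambda+2))$ bits,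 where $\Lambda$ is any upper bound on the labels. -/

import Mathlib

/-! ### Temporal graphs and temporal transitive orientations -/

/-- A (simple) temporal graph `(G, λ)`: every edge of the graph `G` carries one time label in `ℕ`.
The label function is total on unordered pairs; only its values on edges of `G` are ever used. -/
structure TemporalGraph (V : Type*) where
  graph : SimpleGraph V
  label : Sym2 V → ℕ

namespace TemporalGraph

variable {V : Type*}

/-- `O` is an orientation: a set of ordered pairs that consists of exactly one of `(a, b)`, `(b, a)`
for each edge `ab`, and of nothing else. -/
def IsOrientation (𝒢 : TemporalGraph V) (O : Set (V × V)) : Prop :=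
  (∀ a b, (a, b) ∈ O → 𝒢.graph.Adj a b) ∧
    ∀ a b, 𝒢.graph.Adj a b → Xor ((a, b) ∈ O) ((b, a) ∈ O)

/-- `O` is a temporal transitive orientation (TTO). -/
def IsTTO (𝒢 : TemporalGraph V) (O : Set (V × V)) : Prop :=
  𝒢.IsOrientation O ∧
    ∀ a b c, (a, b) ∈ O → (b, c) ∈ O → 𝒢.label s(a, b) ≤ 𝒢.label s(b, c) →
      (a, c) ∈ O ∧ 𝒢.label s(b, c) ≤ 𝒢.label s(a, c)

/-- `𝒢` is a T-comparability temporal graph: it admits a TTO. -/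
def IsTComparability (𝒢 : TemporalGraph V) : Prop :=
  ∃ O : Set (V × V), 𝒢.IsTTO O

/-- The number `m` of edges. -/
noncomputable def numEdges (𝒢 : TemporalGraph V) : ℕ :=
  𝒢.graph.edgeSet.ncard

/-- The number `k` of monolabel triangles: sets of three pairwise adjacent vertices whose three
edges carry the same label. -/
noncomputable def numMonolabelTriangles (𝒢 : TemporalGraph V) : ℕ :=
  {T : Set V | ∃ a b c, T = {a, b, c} ∧
    𝒢.graph.Adj a b ∧ 𝒢.graph.Adj b c ∧ 𝒢.graph.Adj a c ∧
    𝒢.label s(a, b) = 𝒢.label s(b, c) ∧ 𝒢.label s(a, c) = 𝒢.label s(b, c)}.ncard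

/-- `L` lists every edge of `𝒢` exactly once, in any order and with its two endpoints in any
order. -/
def IsEdgeList (𝒢 : TemporalGraph V) (L : List (V × V)) : Prop :=
  (L.map fun p => s(p.1, p.2)).Nodup ∧
    ∀ e : Sym2 V, e ∈ L.map (fun p => s(p.1, p.2)) ↔ e ∈ 𝒢.graph.edgeSet

end TemporalGraph

/-! ### A word random access machine

A program is a fixed finite text over registers `0, 1, 2, …` and arrays `0, 1, 2, …` of natural
numbers (a program mentions only finitely many of them), with indirect addressing, branching and
loops. Every arithmetic operation, memory access and test costs one step. The results of arithmetic
operations have to fit into a machine word. -/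

namespace WordRAM

/-- The contents of the memory. -/
structure Store where
  reg : ℕ → ℕ
  arr : ℕ → ℕ → ℕ

inductive Operand
  | const (c : ℕ)
  | reg (x : ℕ)

def Operand.val (s : Store) : Operand → ℕ
  | .const c => c
  | .reg x => s.reg x

/-- Arithmetic operations; subtraction is truncated at `0`. -/
inductive BinOp
  | add
  | sub
  | mul

def BinOp.eval : BinOp → ℕ → ℕ → ℕ
  | .add, a, b => a + b
  | .sub, a, b => a - b
  | .mul, a, b => a * b

inductive Test
  | lt (a b : Operand)
  | eq (a b : Operand)

def Test.Holds (s : Store) : Test → Prop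
  | .lt a b => a.val s < b.val s
  | .eq a b => a.val s = b.val s

inductive Program
  | skip
  /-- `x := f a b` -/
  | op (f : BinOp) (x : ℕ) (a b : Operand)
  /-- `x := A[i]` -/
  | load (x A : ℕ) (i : Operand)
  /-- `A[i] := v` -/
  | store (A : ℕ) (i v : Operand)
  | seq (p q : Program)
  | ite (c : Test) (p q : Program)
  | while (c : Test) (p : Program)

def Store.setReg (s : Store) (x v : ℕ) : Store :=
  { s with reg := Function.update s.reg x v }

def Store.setArr (s : Store) (A i v : ℕ) : Store :=
  { s with arr := Function.update s.arr A (Function.update (s.arr A) i v) }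

/-- `Exec W p s t s'`: on a machine whose words hold the numbers `0, …, W`, the program `p`, started
with memory `s`, halts after exactly `t` steps with memory `s'`, and no arithmetic operation
overflows. The machine is deterministic. -/
inductive Exec (W : ℕ) : Program → Store → ℕ → Store → Prop
  | skip (s : Store) : Exec W .skip s 1 s
  | op (s : Store) (f : BinOp) (x : ℕ) (a b : Operand) (h : f.eval (a.val s) (b.val s) ≤ W) :
      Exec W (.op f x a b) s 1 (s.setReg x (f.eval (a.val s) (b.val s)))
  | load (s : Store) (x A : ℕ) (i : Operand) :
      Exec W (.load x A i) s 1 (s.setReg x (s.arr A (i.val s)))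
  | store (s : Store) (A : ℕ) (i v : Operand) :
      Exec W (.store A i v) s 1 (s.setArr A (i.val s) (v.val s))
  | seq {p q : Program} {s s' s'' : Store} {t u : ℕ} (hp : Exec W p s t s')
      (hq : Exec W q s' u s'') : Exec W (.seq p q) s (t + u) s''
  | ite_true {c : Test} {p q : Program} {s s' : Store} {t : ℕ} (h : c.Holds s)
      (hp : Exec W p s t s') : Exec W (.ite c p q) s (t + 1) s'
  | ite_false {c : Test} {p q : Program} {s s' : Store} {t : ℕ} (h : ¬ c.Holds s)
      (hq : Exec W q s t s') : Exec W (.ite c p q) s (t + 1) s'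
  | while_true {c : Test} {p : Program} {s s' s'' : Store} {t u : ℕ} (h : c.Holds s)
      (hp : Exec W p s t s') (hw : Exec W (.while c p) s' u s'') :
      Exec W (.while c p) s (t + u + 1) s''
  | while_false {c : Test} {p : Program} {s : Store} (h : ¬ c.Holds s) :
      Exec W (.while c p) s 1 s

end WordRAM

/-! ### Input and output conventions -/

namespace TemporalGraph

open WordRAM

/-- The input: registers `0` and `1` hold the number of vertices and of edges; arrays `0`, `1`, `2`
hold the first endpoints, the second endpoints and the time labels of the listed edges. Everything
else is `0`. -/
def inputStore {n : ℕ} (𝒢 : TemporalGraph (Fin n)) (L : List (Fin n × Fin n)) : Store where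
  reg x := if x = 0 then n else if x = 1 then L.length else 0
  arr A i :=
    match L[i]? with
    | none => 0
    | some (u, v) =>
      if A = 0 then u else if A = 1 then v else if A = 2 then 𝒢.label s(u, v) else 0

/-- The set of the `m` ordered pairs that the machine has written into arrays `3` (tails) and `4`
(heads). -/
def outputArcs (n m : ℕ) (s : Store) : Set (Fin n × Fin n) :=
  {p | ∃ i < m, s.arr 3 i = p.1 ∧ s.arr 4 i = p.2}

/-- The final memory `s` solves the instance: register `0` holds `1` and the output arcs are a TTO
if there is a TTO, and register `0` holds `0` if there is none. -/
def IsSolvedBy {n : ℕ} (𝒢 : TemporalGraph (Fin n)) (s : Store) : Prop :=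
  (𝒢.IsTComparability → s.reg 0 = 1 ∧ 𝒢.IsTTO (outputArcs n 𝒢.numEdges s)) ∧
    (¬ 𝒢.IsTComparability → s.reg 0 = 0)

end TemporalGraph

/-!
Labels are shifted by one, and non-edges get label `0`; this makes every temporal graph a complete
graph with symmetric weights. The condition on a triangle in the definition of a temporal
transitive orientation then amounts to the closure properties of `IsClosed`: an arc `a → b` and a
third vertex `c` may force `c → b` (if `ab` is not heavier than `bc`, and `ac` is lighter than
`bc`) or `a → c`, and in a monolabel triangle two consecutive arcs force the third one. The
temporal transitive orientations are the closed sets of arcs that orient all edges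
(`isTTO_iff_isSolution`).

The key fact is `IsSolution.exists_extension`: if there is any solution at all, then *every*
closed partial orientation `R` extends to a solution. To see this, override a solution `O` by `R`.
The result violates only constraints of monolabel triangles with exactly one edge `ab` in `R`, the
triangle being oriented as `a → b → c → a`. Within each weight the edges not decided by `R` are
oriented acyclically; choose a bad triangle whose middle vertex `b` is lowest in this order, and
turn around the edges `ca` of all bad triangles of that weight with middle vertex `b`. This
creates no new bad triangles and keeps the order acyclic, so that after finitely many rounds there
are no bad triangles left.

Hence decisions never have to be revised. For each edge `uv` that is not yet decided, the
algorithm derives the consequences of `u → v` and of `v → u` in parallel, one unit of work for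
each in turn. The first of the two trials that is completed without a contradiction gives a larger
closed set, which is kept (`Trial.Inv.isClosed`); if both trials lead to a contradiction, there is
no solution, by the key fact. A unit of work combines one derived arc with one third vertex, so
that a trial that derives `ℓ` arcs takes `n * ℓ` units; the abandoned trial has cost no more than
the successful one, whose arcs stay decided for good. As at most `m` arcs are ever decided, the
running time is `O(nm)`, and this is at most the bound to be proved.

The two trials share the permanent decisions by means of time stamps: an arc counts as decided if
its stamp is at least the current one, permanent decisions carry the stamp `m + 1`, and edge
number `e`, counted from `0`, uses the stamp `e + 1`, which makes the remains of abandoned trials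
invalid without any clearing of memory.

The RAM program `orientProg` is verified with the rules `Runs.seq`, `Runs.ite` and `exec_while`;
programs without loops are evaluated symbolically (`runs_of_fits`), and `exec_frame` says that a
program changes only those registers and arrays that it mentions as targets.
-/

set_option linter.unusedSimpArgs false

namespace TemporalOrientation

open TemporalGraph WordRAM

/-! ### Closed partial orientations -/

/-- `IsClosed w R`: the set `R` of arcs is a partial orientation of the graph with edge weights `w`
(weight `0` meaning that there is no edge) which is closed under unit propagation of the constraints
on a temporal transitive orientation. -/
structure IsClosed {V : Type*} (w : V → V → ℕ) (R : V → V → Prop) : Prop where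
  pos : ∀ {a b}, R a b → 0 < w a b
  asymm : ∀ {a b}, R a b → ¬ R b a
  head : ∀ {a b c}, R a b → w a b ≤ w b c → w a c < w b c → R c b
  tail : ∀ {a b c}, R a b → 0 < w a c → w a c ≤ w a b → w b c < w a b → R a c
  trans : ∀ {a b c}, R a b → R b c → w a b = w b c → w a c = w b c → R a c

/-- A closed set of arcs that orients every edge; for the weights of a temporal graph these are the
temporal transitive orientations. -/
structure IsSolution {V : Type*} (w : V → V → ℕ) (O : V → V → Prop) : Prop
    extends IsClosed w O where
  total : ∀ {a b}, 0 < w a b → O a b ∨ O b a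

/-- The edge `ab` is not oriented by `R`. -/
def Undecided {V : Type*} (R : V → V → Prop) (a b : V) : Prop := ¬ R a b ∧ ¬ R b a

theorem Undecided.symm {V : Type*} {R : V → V → Prop} {a b : V} (h : Undecided R a b) :
    Undecided R b a := ⟨h.2, h.1⟩

/-- An orientation `σ` of all edges that extends `R` and satisfies every constraint except possibly
that of a monolabel triangle with exactly one edge oriented by `R`. For the triangles with no such
edge this is expressed by the rank functions: among the undecided edges of one weight, `σ` is
acyclic. -/
structure Almost {V : Type*} (w : V → V → ℕ) (R σ : V → V → Prop) : Prop where
  pos : ∀ {a b}, σ a b → 0 < w a b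
  asymm : ∀ {a b}, σ a b → ¬ σ b a
  total : ∀ {a b}, 0 < w a b → σ a b ∨ σ b a
  ext : ∀ {a b}, R a b → σ a b
  head : ∀ {a b c}, σ a b → w a b ≤ w b c → w a c < w b c → σ c b
  rank : ∀ u, ∃ ρ : V → ℕ, ∀ a b, σ a b → w a b = u → Undecided R a b → ρ a < ρ b

/-- A cyclically oriented monolabel triangle `a → b → c → a` of which `R` orients exactly the edge
`ab`. -/
def Bad {V : Type*} (w : V → V → ℕ) (R σ : V → V → Prop) (a b c : V) : Prop :=
  R a b ∧ w a b = w b c ∧ w c a = w b c ∧ Undecided R b c ∧ Undecided R c a ∧ σ b c ∧ σ c a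

/-- The arc `a → c` replaces `c → a`, because of a bad triangle `a → b → c → a` of weight `u`. The
middle vertex `b` and the weight `u` are kept fixed, and all such arcs are turned around at once. -/
def Flip {V : Type*} (w : V → V → ℕ) (R σ : V → V → Prop) (u : ℕ) (b a c : V) : Prop :=
  Bad w R σ a b c ∧ w a b = u

/-- The orientation after turning these edges around. -/
def flipped {V : Type*} (w : V → V → ℕ) (R σ : V → V → Prop) (u : ℕ) (b x y : V) : Prop :=
  Flip w R σ u b x y ∨ (σ x y ∧ ¬ Flip w R σ u b y x)

section

variable {V : Type*} {w : V → V → ℕ} {R σ : V → V → Prop}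

theorem Almost.tail (h : Almost w R σ) (hw : ∀ a b, w a b = w b a) {a b c : V} (hab : σ a b)
    (h0 : 0 < w a c) (h1 : w a c ≤ w a b) (h2 : w b c < w a b) : σ a c := by
  rcases h.total h0 with h3 | h3
  · exact h3
  · exact absurd (h.head h3 (by rwa [hw c a]) (by rwa [hw c b])) (h.asymm hab)

/-- Without bad triangles an almost-solution is a solution. -/
theorem Almost.isSolution (h : Almost w R σ) (hw : ∀ a b, w a b = w b a) (hR : IsClosed w R)
    (hbad : ∀ a b c, ¬ Bad w R σ a b c) : IsSolution w σ where
  pos := h.pos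
  asymm := h.asymm
  head := h.head
  tail := h.tail hw
  total := h.total
  trans := by
    intro a b c hab hbc h1 h2
    rcases h.total (a := a) (b := c) (by have := h.pos hbc; omega) with hac | hca
    · exact hac
    exfalso
    have key : ∀ {x y}, σ x y → R x y ∨ Undecided R x y := fun {x y} hxy => by
      by_cases h' : R x y
      · exact Or.inl h'
      · exact Or.inr ⟨h', fun h'' => h.asymm hxy (h.ext h'')⟩
    have e1 := hw c a
    have e2 := hw b c
    have e3 := hw a b
    rcases key hab with rab | uab <;> rcases key hbc with rbc | ubc <;>
      rcases key hca with rca | uca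
    · exact h.asymm hca (h.ext (hR.trans rab rbc h1 h2))
    · exact h.asymm hca (h.ext (hR.trans rab rbc h1 h2))
    · exact h.asymm hbc (h.ext (hR.trans rca rab (by omega) (by omega)))
    · exact hbad a b c ⟨rab, h1, by omega, ubc, uca, hbc, hca⟩
    · exact h.asymm hab (h.ext (hR.trans rbc rca (by omega) (by omega)))
    · exact hbad b c a ⟨rbc, by omega, by omega, uca, uab, hca, hab⟩
    · exact hbad c a b ⟨rca, by omega, by omega, uab, ubc, hab, hbc⟩
    · obtain ⟨ρ, hρ⟩ := h.rank (w b c)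
      have := hρ a b hab h1 uab
      have := hρ b c hbc rfl ubc
      have := hρ c a hca (by omega) uca
      omega

/-- A solution, overridden by a closed set of arcs, is an almost-solution. -/
theorem IsSolution.almost_override [Finite V] {O : V → V → Prop} (hO : IsSolution w O)
    (hw : ∀ a b, w a b = w b a) (hR : IsClosed w R) :
    Almost w R (fun x y => R x y ∨ (O x y ∧ ¬ R y x)) where
  pos := by
    rintro a b (h | ⟨h, -⟩)
    · exact hR.pos h
    · exact hO.pos h
  asymm := by
    rintro a b (h | ⟨h, h1⟩) (h' | ⟨h', h1'⟩)
    · exact hR.asymm h h'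
    · exact h1' h
    · exact h1 h'
    · exact hO.asymm h h'
  total := by
    intro a b hab
    have := hO.total hab
    tauto
  ext := Or.inl
  head := by
    rintro a b c (h | ⟨h, h1⟩) h2 h3
    · exact Or.inl (hR.head h h2 h3)
    · refine or_iff_not_imp_left.2 fun h4 => ⟨hO.head h h2 h3, fun h5 => h1 ?_⟩
      -- the contrapositive of the same constraint, applied to `b → c`
      exact hR.tail h5 (by have := hO.pos h; rwa [hw b a]) (by rwa [hw b a]) (by rwa [hw c a])
  rank := by
    intro u
    classical
    let P : V → V → Prop := fun x y => O x y ∧ w x y = u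
    -- a walk of arcs of weight `u` has a shortcut in `O`, hence does not close
    have key : ∀ x y, Relation.TransGen P x y → O x y ∧ u ≤ w x y := by
      intro x y hxy
      induction hxy using Relation.TransGen.head_induction_on with
      | single h => exact ⟨h.1, h.2.ge⟩
      | @head a c hac hcy ih =>
        obtain ⟨h1, h2⟩ := hac
        obtain ⟨h3, h4⟩ := ih
        have h5 : ¬ w a y < w c y := fun h5 => hO.asymm h3 (hO.head h1 (by omega) h5)
        refine ⟨?_, by omega⟩
        rcases hO.total (a := a) (b := y) (by have := hO.pos h3; omega) with h6 | h6
        · exact h6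
        exfalso
        have e1 := hw a y
        have e2 := hw c y
        have e3 := hw a c
        have p := hO.pos h3
        by_cases h7 : w a y = w c y
        · by_cases h8 : u = w c y
          · exact hO.asymm h6 (hO.trans h1 h3 (by omega) (by omega))
          · exact hO.asymm h3 (hO.tail h6 (by omega) (by omega) (by omega))
        · exact hO.asymm h3 (hO.tail h6 (by omega) (by omega) (by omega))
    have irr : ∀ x, ¬ Relation.TransGen P x x := fun x hx =>
      hO.asymm (key x x hx).1 (key x x hx).1
    refine ⟨fun v => {x | Relation.TransGen P x v}.ncard, fun a b hab hu hU => ?_⟩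
    have hab' : P a b := by
      rcases hab with h | h
      · exact absurd h hU.1
      · exact ⟨h.1, hu⟩
    refine Set.ncard_lt_ncard ⟨fun x hx => hx.tail hab', fun hsub => irr a ?_⟩ (Set.toFinite _)
    exact hsub (Relation.TransGen.single hab')

end

section

variable {V : Type*} {w : V → V → ℕ} {R σ : V → V → Prop} {u : ℕ} {b : V}

/-- A vertex joined by an undecided edge to the tail of an arc of `R` of the same weight is joined
to its head by an edge of that weight too. -/
theorem IsClosed.eq_weight (hR : IsClosed w R) (hw : ∀ a b, w a b = w b a) {a b y : V} (h : R a b)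
    (hy : Undecided R a y) (h1 : w a y = w a b) : w b y = w a b := by
  have e1 := hw b y
  have e2 := hw a y
  have e3 := hw a b
  have p := hR.pos h
  rcases lt_trichotomy (w b y) (w a b) with h2 | h2 | h2
  · exact absurd (hR.tail h (by omega) (by omega) (by omega)) hy.1
  · exact h2
  · have h3 : R y b := hR.head h (by omega) (by omega)
    exact absurd (hR.tail h3 (by omega) (by omega) (by omega)) hy.2

theorem Flip.not_symm {a c : V} (h : Flip w R σ u b a c) (c' : V) :
    ¬ Flip w R σ u b c c' := fun h' =>
  h.1.2.2.2.1.2 h'.1.1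

/-- Turning edges around does not violate a constraint on a triangle with two different weights. -/
theorem flipped_head (h : Almost w R σ) (hw : ∀ a b, w a b = w b a) (hR : IsClosed w R)
    {a c x : V} (hac : flipped w R σ u b a c) (h1 : w a c ≤ w c x) (h2 : w a x < w c x) :
    flipped w R σ u b x c := by
  -- no constraint is violated if exactly one of its two edges is turned around
  have A : ∀ {a c x}, Flip w R σ u b a c → w a c ≤ w c x → w a x < w c x → σ c x →
      Flip w R σ u b x c := by
    rintro a c x ⟨⟨rab, e1, e2, ubc, uca, sbc, sca⟩, rfl⟩ h1 h2 h3
    have s1 := hw a c; have s2 := hw b c; have s3 := hw b x; have s4 := hw a x; have s5 := hw c x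
    have s6 := hw a b
    have p := hR.pos rab
    rcases lt_trichotomy (w b x) (w c x) with h4 | h4 | h4
    · exact absurd (h.head sbc (by omega) h4) (h.asymm h3)
    · have r1 : R x b := hR.head rab (by omega) (by omega)
      rcases lt_or_eq_of_le h1 with h5 | h5
      · exact absurd (h.ext (hR.tail r1 (by omega) (by omega) (by omega))) (h.asymm h3)
      · refine ⟨⟨r1, by omega, by omega, ubc, ⟨fun h6 => ?_, fun h6 => ?_⟩, sbc, h3⟩, by omega⟩
        · exact uca.1 (hR.tail h6 (by omega) (by omega) (by omega))
        · exact uca.2 (hR.head h6 (by omega) (by omega))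
    · have r1 : R x b := hR.head rab (by omega) (by omega)
      exact absurd (h.ext (hR.tail r1 (by omega) (by omega) (by omega))) (h.asymm h3)
  have B : ∀ {a c x}, Flip w R σ u b c x → w a c ≤ w c x → w a x < w c x → 0 < w a c → σ a c →
      Flip w R σ u b c a := by
    rintro x a c ⟨⟨rab, e1, e2, ubc, uca, sbc, sca⟩, rfl⟩ h1 h2 h0 h3
    have s1 := hw a c; have s2 := hw b c; have s3 := hw b x; have s4 := hw a x; have s5 := hw c x
    have s6 := hw a b
    have p := hR.pos rab
    rcases lt_trichotomy (w b x) (w a b) with h4 | h4 | h4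
    · exact absurd (h.ext (hR.tail rab (by omega) (by omega) (by omega))) (h.asymm h3)
    · rcases lt_or_eq_of_le h1 with h5 | h5
      · have r1 : R x b := hR.head rab (by omega) (by omega)
        exact absurd (hR.head r1 (by omega) (by omega)) ubc.2
      · have sbx : σ b x := h.tail hw sbc (by omega) (by omega) (by omega)
        refine ⟨⟨rab, by omega, by omega, ⟨fun h6 => ?_, fun h6 => ?_⟩,
          ⟨fun h6 => ?_, fun h6 => ?_⟩,
          sbx, h3⟩, by omega⟩
        · exact ubc.1 (hR.tail h6 (by omega) (by omega) (by omega))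
        · exact ubc.2 (hR.head h6 (by omega) (by omega))
        · exact uca.1 (hR.head h6 (by omega) (by omega))
        · exact uca.2 (hR.tail h6 (by omega) (by omega) (by omega))
    · have r1 : R x b := hR.head rab (by omega) (by omega)
      have r2 : R x a := hR.tail r1 (by omega) (by omega) (by omega)
      exact absurd (hR.head r2 (by omega) (by omega)) uca.1
  have s5 := hw c x
  rcases hac with hac | ⟨hac, hnot⟩
  · have p : 0 < w a c := by
      have := hw a c
      rw [this]; exact h.pos hac.1.2.2.2.2.2.2
    by_cases h3 : σ c x
    · exact Or.inl (A hac h1 h2 h3)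
    · exact Or.inr ⟨(h.total (a := c) (b := x) (by omega)).resolve_left h3, hac.not_symm x⟩
  · by_cases h3 : Flip w R σ u b c x
    · exact absurd (B h3 h1 h2 (h.pos hac) hac) hnot
    · exact Or.inr ⟨h.head hac h1 h2, h3⟩

theorem Flip.rev {a c : V} (h : Flip w R σ u b a c) : σ c a := h.1.2.2.2.2.2.2

/-- Turning edges around does not create a bad triangle `p → q → r → p` with a turned edge `qr`. -/
theorem not_bad_of_flip_left (hw : ∀ a b, w a b = w b a) (hR : IsClosed w R)
    {p q r : V} (hbad : Bad w R (flipped w R σ u b) p q r) : ¬ Flip w R σ u b q r := by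
  intro hF
  have hF' := hF
  obtain ⟨⟨rab, e1, e2, ubc, uca, sbc, sca⟩, rfl⟩ := hF
  obtain ⟨rpq, e3, e4, uqr, urp, -, f2⟩ := hbad
  have s1 := hw p q; have s2 := hw q r; have s3 := hw r p; have s4 := hw p b; have s5 := hw q b
  have s6 := hw r b
  have pp := hR.pos rab
  rcases lt_trichotomy (w p b) (w q b) with h1 | h1 | h1
  · exact hR.asymm rpq (hR.tail rab (by omega) (by omega) (by omega))
  · have rpb : R p b := hR.trans rpq rab (by omega) (by omega)
    rcases f2 with h2 | ⟨h2, h3⟩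
    · exact hF'.not_symm _ h2
    · exact h3 ⟨⟨rpb, by omega, by omega, ubc, urp, sbc, h2⟩, by omega⟩
  · have rpb : R p b := hR.head rab (by omega) (by omega)
    exact urp.2 (hR.tail rpb (by omega) (by omega) (by omega))

/-- Turning edges around does not create a bad triangle `p → q → r → p` with a turned edge `rp`.
This is where the choice of `b` as the lowest middle vertex of a bad triangle is used. -/
theorem not_bad_of_flip_right (h : Almost w R σ) (hw : ∀ a b, w a b = w b a) (hR : IsClosed w R)
    {ρ : V → ℕ} (hρ : ∀ a b, σ a b → w a b = u → Undecided R a b → ρ a < ρ b)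
    (hmin : ∀ a b' c, Bad w R σ a b' c → w a b' = u → ρ b ≤ ρ b')
    {p q r : V} (hbad : Bad w R (flipped w R σ u b) p q r) : ¬ Flip w R σ u b r p := by
  intro hF
  have hF' := hF
  obtain ⟨⟨rab, e1, e2, ubc, uca, sbc, sca⟩, rfl⟩ := hF
  obtain ⟨rpq, e3, e4, uqr, urp, f1, -⟩ := hbad
  have s1 := hw p q; have s2 := hw q r; have s3 := hw r p; have s4 := hw p b; have s5 := hw q b
  have s6 := hw r b
  have pp := hR.pos rab
  have e5 : w b q = w r b := hR.eq_weight hw rab uqr.symm (by omega)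
  have ubq : Undecided R b q :=
    ⟨fun h1 => uqr.2 (hR.trans rab h1 (by omega) (by omega)),
      fun h1 => ubc.2 (hR.trans rpq h1 (by omega) (by omega))⟩
  rcases f1 with h1 | ⟨h1, h2⟩
  · exact ubq.2 h1.1.1
  · rcases h.total (a := b) (b := q) (by omega) with h3 | h3
    · exact h2 ⟨⟨rab, by omega, by omega, ubq, uqr, h3, h1⟩, rfl⟩
    · have h4 := hmin p q b ⟨rpq, by omega, by omega, ubq.symm, ubc, h3, sbc⟩ (by omega)
      have h5 := hρ q b h3 (by omega) ubq.symm
      omega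

/-- Turning edges around does not create bad triangles. -/
theorem Bad.of_flipped (h : Almost w R σ) (hw : ∀ a b, w a b = w b a) (hR : IsClosed w R)
    {ρ : V → ℕ} (hρ : ∀ a b, σ a b → w a b = u → Undecided R a b → ρ a < ρ b)
    (hmin : ∀ a b' c, Bad w R σ a b' c → w a b' = u → ρ b ≤ ρ b')
    {p q r : V} (hbad : Bad w R (flipped w R σ u b) p q r) : Bad w R σ p q r := by
  have h1 := not_bad_of_flip_left hw hR hbad
  have h2 := not_bad_of_flip_right h hw hR hρ hmin hbad
  obtain ⟨rpq, e3, e4, uqr, urp, f1, f2⟩ := hbad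
  exact ⟨rpq, e3, e4, uqr, urp, (f1.resolve_left h1).1, (f2.resolve_left h2).1⟩

/-- The undecided edges of one weight stay acyclic: the tails `a` of the turned arcs have moved to a
place just before `b`. -/
theorem flipped_rank [Finite V] (h : Almost w R σ) (hw : ∀ a b, w a b = w b a) (hR : IsClosed w R)
    {ρ : V → ℕ} (hρ : ∀ a b, σ a b → w a b = u → Undecided R a b → ρ a < ρ b) :
    ∃ ρ' : V → ℕ, ∀ x y, flipped w R σ u b x y → w x y = u → Undecided R x y → ρ' x < ρ' y := by
  classical
  obtain ⟨M, hM⟩ : ∃ M, ∀ v, ρ v < M := by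
    obtain ⟨M, hM⟩ := (Set.finite_range ρ).bddAbove
    exact ⟨M + 1, fun v => Nat.lt_succ_of_le (hM ⟨v, rfl⟩)⟩
  -- first the vertices below `b`, then the tails of the arcs of `R` into `b`, then all others
  refine ⟨fun v => if ρ v < ρ b then ρ v else if R v b ∧ w v b = u then M + ρ v else 2 * M + ρ v,
    fun x y hxy hu hU => ?_⟩
  have hx := hM x
  have hy := hM y
  have hb := hM b
  rcases hxy with hF | ⟨hxy, hnF⟩
  · obtain ⟨⟨rab, e1, e2, ubc, uca, sbc, sca⟩, e3⟩ := hF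
    have h1 := hρ b y sbc (by omega) ubc
    have h2 := hρ y x sca (by omega) uca
    simp only [ubc.2, false_and, if_false, rab, true_and, e3, if_true]
    split_ifs <;> omega
  · have h1 := hρ x y hxy hu hU
    by_cases hyA : R y b ∧ w y b = u
    · by_cases hxA : R x b ∧ w x b = u
      · simp only [hxA, hyA, and_self, if_true]
        split_ifs <;> omega
      · by_cases hxb : ρ x < ρ b
        · simp only [hxb, hyA, and_self, if_true]
          split_ifs <;> omega
        · exfalso
          obtain ⟨ryb, e1⟩ := hyA
          have s1 := hw x y; have s2 := hw b x; have s3 := hw y b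
          have e2 : w b x = w y b := hR.eq_weight hw ryb hU.symm (by omega)
          have ubx : Undecided R b x :=
            ⟨fun h2 => hU.2 (hR.trans ryb h2 (by omega) (by omega)),
              fun h2 => hxA ⟨h2, by omega⟩⟩
          have p := hR.pos ryb
          rcases h.total (a := b) (b := x) (by omega) with h3 | h3
          · exact hnF ⟨⟨ryb, by omega, by omega, ubx, hU, h3, hxy⟩, e1⟩
          · exact hxb (hρ x b h3 (by omega) ubx.symm)
    · simp only [hyA, if_false]
      split_ifs <;> omega

theorem Almost.flipped [Finite V] (h : Almost w R σ) (hw : ∀ a b, w a b = w b a)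
    (hR : IsClosed w R) : Almost w R (flipped w R σ u b) where
  pos := by
    rintro x y (hF | ⟨hxy, -⟩)
    · rw [hw]; exact h.pos hF.rev
    · exact h.pos hxy
  asymm := by
    rintro x y (h1 | ⟨h1, h1'⟩) (h2 | ⟨h2, h2'⟩)
    · exact h1.not_symm _ h2
    · exact h2' h1
    · exact h1' h2
    · exact h.asymm h1 h2
  total := by
    intro x y hxy
    have := h.total hxy
    unfold TemporalOrientation.flipped
    tauto
  ext := fun hxy => Or.inr ⟨h.ext hxy, fun hF => hF.1.2.2.2.2.1.1 hxy⟩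
  head := fun h1 h2 h3 => flipped_head h hw hR h1 h2 h3
  rank := by
    intro u'
    by_cases hu : u' = u
    · subst hu
      obtain ⟨ρ, hρ⟩ := h.rank u'
      exact flipped_rank h hw hR hρ
    · obtain ⟨ρ, hρ⟩ := h.rank u'
      refine ⟨ρ, fun x y hxy h1 h2 => ?_⟩
      rcases hxy with hF | hxy
      · obtain ⟨⟨rab, e1, e2, -⟩, e3⟩ := hF
        have := hw x y
        omega
      · exact hρ x y hxy.1 h1 h2

/-- An almost-solution can be turned into a solution, by removing bad triangles one middle vertex at
a time. -/
theorem Almost.exists_isSolution [Finite V] (hw : ∀ a b, w a b = w b a) (hR : IsClosed w R)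
    (h : Almost w R σ) : ∃ O, IsSolution w O ∧ ∀ a b, R a b → O a b := by
  induction hk : {t : V × V × V | Bad w R σ t.1 t.2.1 t.2.2}.ncard using Nat.strong_induction_on
    generalizing σ with
  | _ k ih =>
    by_cases hbad : ∃ a b c, Bad w R σ a b c
    · obtain ⟨a₀, b₀, c₀, h0⟩ := hbad
      obtain ⟨ρ, hρ⟩ := h.rank (w a₀ b₀)
      obtain ⟨b, ⟨a, c, h1, h2⟩, hmin⟩ := (Set.toFinite
        {b | ∃ a c, Bad w R σ a b c ∧ w a b = w a₀ b₀}).exists_minimalFor ρ _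
          ⟨b₀, a₀, c₀, h0, rfl⟩
      have hmin' : ∀ a b' c, Bad w R σ a b' c → w a b' = w a₀ b₀ → ρ b ≤ ρ b' := by
        intro a' b' c' h3 h4
        by_contra h5
        exact h5 (hmin ⟨a', c', h3, h4⟩ (by omega))
      refine ih _ ?_ (h.flipped hw hR (u := w a₀ b₀) (b := b)) rfl
      rw [← hk]
      refine Set.ncard_lt_ncard ⟨fun t ht => ht.of_flipped h hw hR hρ hmin', fun hsub => ?_⟩
        (Set.toFinite _)
      have h3 : Bad w R (TemporalOrientation.flipped w R σ (w a₀ b₀) b) a b c := @hsub (a, b, c) h1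
      have hF : Flip w R σ (w a₀ b₀) b a c := ⟨h1, h2⟩
      rcases h3.2.2.2.2.2.2 with h4 | h4
      · exact hF.not_symm _ h4
      · exact h4.2 hF
    · push Not at hbad
      exact ⟨σ, h.isSolution hw hR hbad, fun a b => h.ext⟩

/-- If there is a solution at all, then every closed set of arcs extends to a solution. -/
theorem IsSolution.exists_extension [Finite V] {O : V → V → Prop} (hO : IsSolution w O)
    (hw : ∀ a b, w a b = w b a) (hR : IsClosed w R) :
    ∃ O', IsSolution w O' ∧ ∀ a b, R a b → O' a b :=
  (hO.almost_override hw hR).exists_isSolution hw hR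

end

/-! ### Temporal graphs as weighted complete graphs -/

open Classical in
/-- The weight of a pair: the label of the edge, shifted by one, and `0` for a pair that is not an
edge. -/
noncomputable def weight {V : Type*} (𝒢 : TemporalGraph V) (a b : V) : ℕ :=
  if 𝒢.graph.Adj a b then 𝒢.label s(a, b) + 1 else 0

section

variable {V : Type*} (𝒢 : TemporalGraph V)

theorem weight_comm (a b : V) : weight 𝒢 a b = weight 𝒢 b a := by
  unfold weight
  rw [Sym2.eq_swap]
  by_cases h : 𝒢.graph.Adj a b
  · rw [if_pos h, if_pos h.symm]
  · rw [if_neg h, if_neg fun h' => h h'.symm]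

theorem weight_pos_iff {a b : V} : 0 < weight 𝒢 a b ↔ 𝒢.graph.Adj a b := by
  unfold weight; split_ifs <;> simp_all

theorem weight_of_adj {a b : V} (h : 𝒢.graph.Adj a b) :
    weight 𝒢 a b = 𝒢.label s(a, b) + 1 := if_pos h

theorem weight_self (a : V) : weight 𝒢 a a = 0 := if_neg (𝒢.graph.loopless.irrefl a)

/-- The temporal transitive orientations are the closed orientations of all edges. -/
theorem isTTO_iff_isSolution (O : Set (V × V)) :
    𝒢.IsTTO O ↔ IsSolution (weight 𝒢) fun a b => (a, b) ∈ O := by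
  constructor
  · rintro ⟨⟨h1, h2⟩, h3⟩
    have asym : ∀ {a b}, (a, b) ∈ O → (b, a) ∉ O := fun {a b} hab hba => by
      rcases h2 a b (h1 a b hab) with h | h
      · exact h.2 hba
      · exact h.2 hab
    have tot : ∀ {a b}, 0 < weight 𝒢 a b → (a, b) ∈ O ∨ (b, a) ∈ O := fun {a b} h => by
      rcases h2 a b ((weight_pos_iff 𝒢).1 h) with h | h
      · exact Or.inl h.1
      · exact Or.inr h.1
    have pos : ∀ {a b}, (a, b) ∈ O → 0 < weight 𝒢 a b := fun {a b} hab =>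
      (weight_pos_iff 𝒢).2 (h1 a b hab)
    have key : ∀ {a b c}, (a, b) ∈ O → (b, c) ∈ O → weight 𝒢 a b ≤ weight 𝒢 b c →
        (a, c) ∈ O ∧ weight 𝒢 b c ≤ weight 𝒢 a c := fun {a b c} hab hbc h => by
      rw [weight_of_adj 𝒢 (h1 a b hab), weight_of_adj 𝒢 (h1 b c hbc)] at h
      obtain ⟨hac, h'⟩ := h3 a b c hab hbc (by omega)
      rw [weight_of_adj 𝒢 (h1 a c hac), weight_of_adj 𝒢 (h1 b c hbc)]
      exact ⟨hac, by omega⟩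
    refine { pos := pos, asymm := asym, total := tot, head := ?_, tail := ?_, trans := ?_ }
    · intro a b c hab h4 h5
      have p := pos hab
      refine (tot (a := c) (b := b) (by rw [weight_comm]; omega)).resolve_right fun hbc => ?_
      have := (key hab hbc h4).2
      omega
    · intro a b c hab h0 h4 h5
      refine (tot h0).resolve_right fun hca => ?_
      have e1 := weight_comm 𝒢 a c
      have e2 := weight_comm 𝒢 b c
      have := (key hca hab (by omega)).2
      omega
    · intro a b c hab hbc h4 h5
      exact (key hab hbc h4.le).1
  · intro h
    refine ⟨⟨fun a b hab => (weight_pos_iff 𝒢).1 (h.pos hab), fun a b hab => ?_⟩,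
      fun a b c hab hbc hle => ?_⟩
    · rcases h.total ((weight_pos_iff 𝒢).2 hab) with h1 | h1
      · exact Or.inl ⟨h1, h.asymm h1⟩
      · exact Or.inr ⟨h1, h.asymm h1⟩
    · have aab := (weight_pos_iff 𝒢).1 (h.pos hab)
      have abc := (weight_pos_iff 𝒢).1 (h.pos hbc)
      have wab := weight_of_adj 𝒢 aab
      have wbc := weight_of_adj 𝒢 abc
      have h1 : ¬ weight 𝒢 a c < weight 𝒢 b c := fun h1 =>
        h.asymm hbc (h.head hab (by omega) h1)
      have aac : 𝒢.graph.Adj a c := (weight_pos_iff 𝒢).1 (by omega)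
      have wac := weight_of_adj 𝒢 aac
      refine ⟨?_, by omega⟩
      rcases h.total ((weight_pos_iff 𝒢).2 aac) with h2 | h2
      · exact h2
      exfalso
      have e1 := weight_comm 𝒢 a c
      have e2 := weight_comm 𝒢 b c
      have e3 := weight_comm 𝒢 a b
      by_cases h3 : weight 𝒢 a c = weight 𝒢 b c ∧ weight 𝒢 a b = weight 𝒢 b c
      · exact h.asymm h2 (h.trans hab hbc h3.2 h3.1)
      · exact h.asymm hbc (h.tail h2 (by omega) (by omega) (by omega))

end

/-! ### Running times of programs -/

instance (s : Store) : ∀ c : Test, Decidable (c.Holds s)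
  | .lt a b => inferInstanceAs (Decidable (a.val s < b.val s))
  | .eq a b => inferInstanceAs (Decidable (a.val s = b.val s))

/-- `p`, started with memory `s`, halts within `T` steps with a memory that satisfies `Q`. -/
def Runs (W : ℕ) (p : Program) (s : Store) (T : ℕ) (Q : Store → Prop) : Prop :=
  ∃ t s', Exec W p s t s' ∧ t ≤ T ∧ Q s'

section

variable {W : ℕ} {p q : Program} {s : Store} {T U : ℕ} {Q Q' : Store → Prop}

theorem Runs.mono (h : Runs W p s T Q) (hT : T ≤ U) (hQ : ∀ s', Q s' → Q' s') :
    Runs W p s U Q' := by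
  obtain ⟨t, s', h1, h2, h3⟩ := h
  exact ⟨t, s', h1, h2.trans hT, hQ _ h3⟩

theorem Runs.seq (hp : Runs W p s T Q) (hq : ∀ s', Q s' → Runs W q s' U Q') :
    Runs W (.seq p q) s (T + U) Q' := by
  obtain ⟨t, s', h1, h2, h3⟩ := hp
  obtain ⟨u, s'', h4, h5, h6⟩ := hq s' h3
  exact ⟨t + u, s'', .seq h1 h4, by omega, h6⟩

theorem Runs.ite {c : Test} (hp : c.Holds s → Runs W p s T Q)
    (hq : ¬ c.Holds s → Runs W q s T Q) : Runs W (.ite c p q) s (T + 1) Q := by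
  by_cases h : c.Holds s
  · obtain ⟨t, s', h1, h2, h3⟩ := hp h
    exact ⟨t + 1, s', .ite_true h h1, by omega, h3⟩
  · obtain ⟨t, s', h1, h2, h3⟩ := hq h
    exact ⟨t + 1, s', .ite_false h h1, by omega, h3⟩

/-- The rule for loops. The invariant `I` takes the time spent so far as an argument; a bound for it
that holds throughout gives termination. -/
theorem exec_while {c : Test} {B : ℕ} (I : ℕ → Store → Prop) (h0 : I 0 s)
    (hB : ∀ t s, I t s → t ≤ B)
    (hstep : ∀ t s, I t s → c.Holds s → ∃ u s', Exec W p s u s' ∧ I (t + u + 1) s') :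
    ∃ t s', Exec W (.while c p) s (t + 1) s' ∧ I t s' ∧ ¬ c.Holds s' := by
  have key : ∀ k t s, B - t = k → I t s →
      ∃ u s', Exec W (.while c p) s (u + 1) s' ∧ I (t + u) s' ∧ ¬ c.Holds s' := by
    intro k
    induction k using Nat.strong_induction_on with
    | _ k ih =>
      intro t s hk hI
      by_cases hc : c.Holds s
      · obtain ⟨u, s', h1, h2⟩ := hstep t s hI hc
        have h3 := hB _ _ h2
        obtain ⟨u', s'', h4, h5, h6⟩ := ih (B - (t + u + 1)) (by omega) _ s' rfl h2
        refine ⟨u + (u' + 1), s'', .while_true hc h1 h4, ?_, h6⟩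
        rwa [show t + (u + (u' + 1)) = t + u + 1 + u' by omega]
      · exact ⟨0, s, .while_false hc, hI, hc⟩
  obtain ⟨u, s', h1, h2, h3⟩ := key _ 0 s rfl h0
  exact ⟨u, s', h1, by rwa [Nat.zero_add] at h2, h3⟩

end

/-- The registers that a program writes. -/
def regsOf : Program → List ℕ
  | .skip => []
  | .op _ x _ _ => [x]
  | .load x _ _ => [x]
  | .store _ _ _ => []
  | .seq p q => regsOf p ++ regsOf q
  | .ite _ p q => regsOf p ++ regsOf q
  | .while _ p => regsOf p

/-- The arrays that a program writes. -/
def arrsOf : Program → List ℕ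
  | .skip => []
  | .op _ _ _ _ => []
  | .load _ _ _ => []
  | .store A _ _ => [A]
  | .seq p q => arrsOf p ++ arrsOf q
  | .ite _ p q => arrsOf p ++ arrsOf q
  | .while _ p => arrsOf p

theorem exec_frame {W t : ℕ} {p : Program} {s s' : Store} (h : Exec W p s t s') :
    (∀ x ∉ regsOf p, s'.reg x = s.reg x) ∧ ∀ A ∉ arrsOf p, s'.arr A = s.arr A := by
  induction h with
  | skip => simp
  | op s f x a b _ => simp +contextual [regsOf, Store.setReg]
  | load s x A i => simp +contextual [regsOf, Store.setReg]
  | store s A i v => simp +contextual [arrsOf, Store.setArr]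
  | seq _ _ ih1 ih2 =>
    simp only [regsOf, arrsOf, List.mem_append, not_or]
    exact ⟨fun x hx => (ih2.1 x hx.2).trans (ih1.1 x hx.1),
      fun x hx => (ih2.2 x hx.2).trans (ih1.2 x hx.1)⟩
  | ite_true _ _ ih =>
    simp only [regsOf, arrsOf, List.mem_append, not_or]
    exact ⟨fun x hx => ih.1 x hx.1, fun x hx => ih.2 x hx.1⟩
  | ite_false _ _ ih =>
    simp only [regsOf, arrsOf, List.mem_append, not_or]
    exact ⟨fun x hx => ih.1 x hx.2, fun x hx => ih.2 x hx.2⟩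
  | while_true _ _ _ ih1 ih2 =>
    exact ⟨fun x hx => (ih2.1 x hx).trans (ih1.1 x hx),
      fun x hx => (ih2.2 x hx).trans (ih1.2 x hx)⟩
  | while_false => simp

/-- Registers and arrays that a program does not write keep their contents. -/
theorem Runs.frame {W T : ℕ} {p : Program} {s : Store} {Q : Store → Prop} (h : Runs W p s T Q) :
    Runs W p s T fun s' => Q s' ∧ (∀ x ∉ regsOf p, s'.reg x = s.reg x) ∧
      ∀ A ∉ arrsOf p, s'.arr A = s.arr A := by
  obtain ⟨t, s', h1, h2, h3⟩ := h
  exact ⟨t, s', h1, h2, h3, exec_frame h1⟩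

/-- The final memory of a program without loops. -/
def run : Program → Store → Store
  | .skip, s => s
  | .op f x a b, s => s.setReg x (f.eval (a.val s) (b.val s))
  | .load x A i, s => s.setReg x (s.arr A (i.val s))
  | .store A i v, s => s.setArr A (i.val s) (v.val s)
  | .seq p q, s => run q (run p s)
  | .ite c p q, s => if c.Holds s then run p s else run q s
  | .while _ _, s => s

/-- No arithmetic operation of a program without loops overflows. -/
def Fits (W : ℕ) : Program → Store → Prop
  | .skip, _ => True
  | .op f _ a b, s => f.eval (a.val s) (b.val s) ≤ W
  | .load _ _ _, _ => True
  | .store _ _ _, _ => True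
  | .seq p q, s => Fits W p s ∧ Fits W q (run p s)
  | .ite c p q, s => (c.Holds s → Fits W p s) ∧ (¬ c.Holds s → Fits W q s)
  | .while _ _, _ => False

/-- A bound for the running time of a program without loops. -/
def cost : Program → ℕ
  | .seq p q => cost p + cost q
  | .ite _ p q => max (cost p) (cost q) + 1
  | _ => 1

theorem runs_of_fits {W : ℕ} (p : Program) (s : Store) (h : Fits W p s) :
    Runs W p s (cost p) fun s' => s' = run p s := by
  induction p generalizing s with
  | skip => exact ⟨1, s, .skip s, le_rfl, rfl⟩
  | op f x a b => exact ⟨1, _, .op s f x a b h, le_rfl, rfl⟩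
  | load x A i => exact ⟨1, _, .load s x A i, le_rfl, rfl⟩
  | store A i v => exact ⟨1, _, .store s A i v, le_rfl, rfl⟩
  | seq p q ihp ihq => exact (ihp s h.1).seq fun s' hs' => by subst hs'; exact ihq _ h.2
  | ite c p q ihp ihq =>
    refine Runs.ite (fun hc => (ihp s (h.1 hc)).mono (le_max_left _ _) ?_)
      fun hc => (ihq s (h.2 hc)).mono (le_max_right _ _) ?_
    · rintro s' rfl; simp [run, hc]
    · rintro s' rfl; simp [run, hc]
  | _ => exact h.elim

/-! ### Unit propagation -/

/-- The state of the propagation of a tentative arc: the list `queue` of all arcs derived so far,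
the position `head` in the queue of the arc that is being processed, the third vertex `pos` with
which it is to be combined next, and a `status`: `0` (running), `1` (completed without conflict) or
`2` (conflict). -/
structure Trial (n : ℕ) where
  queue : List (Fin n × Fin n)
  head : ℕ
  pos : ℕ
  status : ℕ

namespace Trial

variable {n : ℕ}

/-- The arcs decided before the trial, together with those derived in it. -/
def arcs (S : Set (Fin n × Fin n)) (T : Trial n) : Set (Fin n × Fin n) :=
  {p | p ∈ S ∨ p ∈ T.queue}

/-- The initial state, in which only the tentative arc is known. -/
def start (x : Fin n × Fin n) : Trial n := ⟨[x], 0, 0, 0⟩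

open Classical in
/-- Record that the arc `(x, y)` has been derived. -/
noncomputable def force (S : Set (Fin n × Fin n)) (x y : Fin n) (T : Trial n) : Trial n :=
  if (x, y) ∈ T.arcs S then T
  else if (y, x) ∈ T.arcs S then { T with status := 2 }
  else { T with queue := T.queue ++ [(x, y)] }

/-- The arc `(a, b)` and the third vertex `c` yield the arc `(c, b)`. -/
def YieldsHead (w : Fin n → Fin n → ℕ) (R : Set (Fin n × Fin n)) (a b c : Fin n) : Prop :=
  (w a b ≤ w b c ∧ w a c < w b c) ∨ (w a b = w b c ∧ w a c = w b c ∧ (c, a) ∈ R)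

/-- The arc `(a, b)` and the third vertex `c` yield the arc `(a, c)`. -/
def YieldsTail (w : Fin n → Fin n → ℕ) (R : Set (Fin n × Fin n)) (a b c : Fin n) : Prop :=
  (0 < w a c ∧ w a c ≤ w a b ∧ w b c < w a b) ∨
    (w a b = w b c ∧ w a c = w b c ∧ (b, c) ∈ R)

open Classical in
/-- Derive the arc `(c, b)` if possible. -/
noncomputable def scanHead (w : Fin n → Fin n → ℕ) (S : Set (Fin n × Fin n)) (a b c : Fin n)
    (T : Trial n) : Trial n :=
  if YieldsHead w (T.arcs S) a b c then T.force S c b else T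

open Classical in
/-- Derive the arc `(a, c)` if possible. -/
noncomputable def scanTail (w : Fin n → Fin n → ℕ) (S : Set (Fin n × Fin n)) (a b c : Fin n)
    (T : Trial n) : Trial n :=
  if YieldsTail w (T.arcs S) a b c then T.force S a c else T

/-- Move on to the next third vertex, or to the next arc of the queue. -/
def advance (T : Trial n) : Trial n :=
  if T.pos + 1 < n then { T with pos := T.pos + 1 }
  else if T.status = 0 ∧ T.head + 1 = T.queue.length then
    { T with head := T.head + 1, pos := 0, status := 1 }
  else { T with head := T.head + 1, pos := 0 }

/-- The pair of the arc `p` and the third vertex `c` has been processed; for the arcs in `S` all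
pairs count as processed. -/
def Done (S : Set (Fin n × Fin n)) (T : Trial n) (p : Fin n × Fin n) (c : Fin n) : Prop :=
  p ∈ S ∨ ∃ i, T.queue[i]? = some p ∧ (i < T.head ∨ i = T.head ∧ c.val < T.pos)

/-- All consequences of the pairs with property `D` (later: the processed ones) lie in `R`. The
third arc of a monolabel triangle is required only once both pairs that yield it have been
processed; it is derived when the later of the two is. -/
structure Saturated (w : Fin n → Fin n → ℕ) (D : Fin n × Fin n → Fin n → Prop)
    (R : Set (Fin n × Fin n)) : Prop where
  head : ∀ {a b c}, D (a, b) c → w a b ≤ w b c → w a c < w b c → (c, b) ∈ R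
  tail : ∀ {a b c}, D (a, b) c → 0 < w a c → w a c ≤ w a b → w b c < w a b → (a, c) ∈ R
  trans : ∀ {a b c}, D (a, b) c → D (b, c) a → w a b = w b c → w a c = w b c → (a, c) ∈ R

/-- The facts about a trial of the arc `x` that hold at any moment. By `forced`, only necessary
consequences are derived, so that a conflict means that no solution contains `S` and `x`. -/
structure Sound (w : Fin n → Fin n → ℕ) (S : Set (Fin n × Fin n)) (x : Fin n × Fin n)
    (T : Trial n) : Prop where
  nodup : T.queue.Nodup
  notMem : ∀ p ∈ T.queue, p ∉ S
  pos : ∀ p ∈ T.queue, 0 < w p.1 p.2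
  asymm : ∀ p ∈ T.queue, p.swap ∉ T.arcs S
  start_mem : x ∈ T.queue
  forced : ∀ O : Set (Fin n × Fin n), IsSolution w (fun a b => (a, b) ∈ O) → S ⊆ O → x ∈ O →
    (∀ p ∈ T.queue, p ∈ O) ∧ T.status ≠ 2

/-- The invariant of a trial. -/
structure Inv (w : Fin n → Fin n → ℕ) (S : Set (Fin n × Fin n)) (x : Fin n × Fin n)
    (T : Trial n) : Prop extends Sound w S x T where
  pos_lt : T.pos < n
  head_lt : T.status = 0 → T.head < T.queue.length
  finished : T.status = 1 → T.head = T.queue.length ∧ T.pos = 0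
  status_le : T.status ≤ 2
  saturated : T.status ≠ 2 → Saturated w (T.Done S) (T.arcs S)

variable {w : Fin n → Fin n → ℕ} {S : Set (Fin n × Fin n)} {x : Fin n × Fin n} {T : Trial n}

/-- A queue appended at its end, with the same position in it. -/
structure Le (T T' : Trial n) : Prop where
  isPrefix : T.queue <+: T'.queue
  head : T'.head = T.head
  pos : T'.pos = T.pos

theorem Le.refl (T : Trial n) : Le T T := ⟨List.prefix_refl _, rfl, rfl⟩

theorem Le.trans {T T' T'' : Trial n} (h : Le T T') (h' : Le T' T'') : Le T T'' :=
  ⟨h.isPrefix.trans h'.isPrefix, h'.head.trans h.head, h'.pos.trans h.pos⟩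

theorem Le.arcs {T T' : Trial n} (h : Le T T') : T.arcs S ⊆ T'.arcs S := by
  rintro p (hp | hp)
  · exact Or.inl hp
  · exact Or.inr (h.isPrefix.subset hp)

theorem le_force (a b : Fin n) : Le T (T.force S a b) := by
  unfold force
  split_ifs
  · exact Le.refl T
  · exact ⟨List.prefix_refl _, rfl, rfl⟩
  · exact ⟨List.prefix_append _ _, rfl, rfl⟩

theorem status_force (a b : Fin n) :
    ((T.force S a b).status = 2 ∨ (T.force S a b).status = T.status) := by
  unfold force; split_ifs <;> simp

theorem mem_force {a b : Fin n} (h : (T.force S a b).status ≠ 2) :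
    (a, b) ∈ (T.force S a b).arcs S := by
  unfold force at h ⊢
  split_ifs at h ⊢ with h1 h2
  · exact h1
  · exact absurd rfl h
  · exact Or.inr (by simp)

theorem Sound.force (hT : Sound w S x T) {a b : Fin n}
    (hab : 0 < w a b) (hne : a ≠ b)
    (hO : ∀ O : Set (Fin n × Fin n), IsSolution w (fun a b => (a, b) ∈ O) → T.arcs S ⊆ O →
      (a, b) ∈ O) : Sound w S x (T.force S a b) := by
  have hsub : ∀ O : Set (Fin n × Fin n), IsSolution w (fun a b => (a, b) ∈ O) → S ⊆ O → x ∈ O →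
      T.arcs S ⊆ O := by
    rintro O h1 h2 h3 p (hp | hp)
    · exact h2 hp
    · exact (hT.forced O h1 h2 h3).1 p hp
  unfold Trial.force
  split_ifs with h1 h2
  · exact hT
  · exact ⟨hT.nodup, hT.notMem, hT.pos, hT.asymm, hT.start_mem, fun O h3 h4 h5 =>
      absurd (hsub O h3 h4 h5 h2) (h3.asymm (hO O h3 (hsub O h3 h4 h5)))⟩
  · refine ⟨?_, ?_, ?_, ?_, ?_, ?_⟩
    · refine List.nodup_append.2 ⟨hT.nodup, by simp, ?_⟩
      intro p hp q hq
      rw [List.mem_singleton] at hq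
      subst hq
      rintro rfl
      exact h1 (Or.inr hp)
    · intro p hp
      rcases List.mem_append.1 hp with hp | hp
      · exact hT.notMem p hp
      · rw [List.mem_singleton] at hp
        subst hp
        exact fun h => h1 (Or.inl h)
    · intro p hp
      rcases List.mem_append.1 hp with hp | hp
      · exact hT.pos p hp
      · rw [List.mem_singleton] at hp
        subst hp
        exact hab
    · rintro p hp
      rcases List.mem_append.1 hp with hp | hp
      · rintro (h | h)
        · exact hT.asymm p hp (Or.inl h)
        · rcases List.mem_append.1 h with h | h
          · exact hT.asymm p hp (Or.inr h)
          · rw [List.mem_singleton] at h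
            apply h2
            have h3 : p = (b, a) := by rw [← Prod.swap_swap p, h]; rfl
            exact Or.inr (h3 ▸ hp)
      · rw [List.mem_singleton] at hp
        subst hp
        rintro (h | h)
        · exact h2 (Or.inl h)
        · rcases List.mem_append.1 h with h | h
          · exact h2 (Or.inr h)
          · rw [List.mem_singleton] at h
            exact hne (congrArg Prod.snd h)
    · exact List.mem_append_left _ hT.start_mem
    · intro O h3 h4 h5
      refine ⟨fun p hp => ?_, (hT.forced O h3 h4 h5).2⟩
      rcases List.mem_append.1 hp with hp | hp
      · exact (hT.forced O h3 h4 h5).1 p hp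
      · rw [List.mem_singleton] at hp
        subst hp
        exact hO O h3 (hsub O h3 h4 h5)

/-- The result of processing an arc `(a, b)` and a third vertex `c`. -/
theorem scan_spec (hT : Sound w S x T) (hw : ∀ a b, w a b = w b a) (h0 : ∀ a, w a a = 0)
    {a b c : Fin n} (hab : (a, b) ∈ T.arcs S) (hpos : 0 < w a b) :
    ∀ T', T' = (T.scanHead w S a b c).scanTail w S a b c →
    Sound w S x T' ∧ Le T T' ∧ (T'.status = 2 ∨ T'.status = T.status) ∧
      (T'.status ≠ 2 → (YieldsHead w (T.arcs S) a b c → (c, b) ∈ T'.arcs S) ∧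
        (YieldsTail w (T.arcs S) a b c → (a, c) ∈ T'.arcs S)) := by
  have ne_of_pos : ∀ {a b}, 0 < w a b → a ≠ b := by
    rintro a b h rfl
    rw [h0] at h; omega
  -- the second derivation starts from the arcs left by the first one
  obtain ⟨s1, l1, e1, y1⟩ : Sound w S x (T.scanHead w S a b c) ∧ Le T (T.scanHead w S a b c) ∧
      ((T.scanHead w S a b c).status = 2 ∨ (T.scanHead w S a b c).status = T.status) ∧
      ((T.scanHead w S a b c).status ≠ 2 → YieldsHead w (T.arcs S) a b c →
        (c, b) ∈ (T.scanHead w S a b c).arcs S) := by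
    unfold scanHead
    split_ifs with hY
    · have hbc : 0 < w c b := by
        rw [hw]
        rcases hY with h | h <;> omega
      refine ⟨hT.force hbc (ne_of_pos hbc) fun O hO hsub => ?_, le_force c b, status_force c b,
        fun h _ => mem_force h⟩
      rcases hY with ⟨h1, h2⟩ | ⟨h1, h2, h3⟩
      · exact hO.head (hsub hab) h1 h2
      · exact hO.trans (hsub h3) (hsub hab) (by rw [hw c a]; omega) (by rw [hw c b]; omega)
    · exact ⟨hT, Le.refl T, Or.inr rfl, fun _ h => absurd h hY⟩
  generalize T.scanHead w S a b c = T₁ at *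
  rintro _ rfl
  have hab₁ : (a, b) ∈ T₁.arcs S := l1.arcs hab
  have mono : YieldsTail w (T.arcs S) a b c → YieldsTail w (T₁.arcs S) a b c := by
    rintro (h | ⟨h1, h2, h3⟩)
    · exact Or.inl h
    · exact Or.inr ⟨h1, h2, l1.arcs h3⟩
  unfold scanTail
  split_ifs with hY
  · have hac : 0 < w a c := by rcases hY with h | h <;> omega
    refine ⟨s1.force hac (ne_of_pos hac) fun O hO hsub => ?_, l1.trans (le_force a c), ?_,
      fun h => ⟨fun h' => ?_, fun _ => mem_force h⟩⟩
    · rcases hY with ⟨h1, h2, h3⟩ | ⟨h1, h2, h3⟩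
      · exact hO.tail (hsub hab₁) h1 h2 h3
      · exact hO.trans (hsub hab₁) (hsub h3) h1 h2
    · rcases status_force (T := T₁) (S := S) a c with h | h
      · exact Or.inl h
      · rwa [h]
    · refine (le_force a c).arcs (y1 (fun h1 => h ?_) h')
      rcases status_force (T := T₁) (S := S) a c with h2 | h2
      · exact h2
      · rwa [h2]
  · exact ⟨s1, l1, e1, fun h => ⟨y1 h, fun h' => absurd (mono h') hY⟩⟩

theorem arcs_advance : T.advance.arcs S = T.arcs S := by
  unfold advance; split_ifs <;> rfl

theorem queue_advance : T.advance.queue = T.queue := by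
  unfold advance; split_ifs <;> rfl

theorem status_advance_eq_two : T.advance.status = 2 ↔ T.status = 2 := by
  unfold advance
  split_ifs with h1 h2
  · rfl
  · simp [h2.1]
  · rfl

theorem Sound.advance (hT : Sound w S x T) : Sound w S x T.advance := by
  have h := queue_advance (T := T)
  have h' := arcs_advance (T := T) (S := S)
  refine ⟨?_, ?_, ?_, ?_, ?_, ?_⟩
  · rw [h]; exact hT.nodup
  · rw [h]; exact hT.notMem
  · rw [h]; exact hT.pos
  · rw [h, h']; exact hT.asymm
  · rw [h]; exact hT.start_mem
  · intro O h1 h2 h3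
    rw [h, Ne, status_advance_eq_two]
    exact hT.forced O h1 h2 h3

/-- One pair of an arc and a third vertex is processed in each step, and only the pair at the
current position. -/
theorem Done.of_advance {p : Fin n × Fin n} {c : Fin n} (h : T.advance.Done S p c) :
    T.Done S p c ∨ (T.queue[T.head]? = some p ∧ c.val = T.pos) ∨
      (T.queue[T.head]? = some p ∧ T.pos < c.val ∧ n ≤ T.pos + 1) := by
  rcases h with h | ⟨i, h1, h2⟩
  · exact Or.inl (Or.inl h)
  rw [queue_advance] at h1
  unfold advance at h2
  have := c.isLt
  split_ifs at h2 with h3 h4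
  · simp only at h2
    rcases h2 with h2 | ⟨h2, h5⟩
    · exact Or.inl (Or.inr ⟨i, h1, Or.inl h2⟩)
    · subst h2
      rcases Nat.lt_succ_iff_lt_or_eq.1 h5 with h6 | h6
      · exact Or.inl (Or.inr ⟨_, h1, Or.inr ⟨rfl, h6⟩⟩)
      · exact Or.inr (Or.inl ⟨h1, h6⟩)
  all_goals
    simp only [Nat.not_lt_zero, and_false, or_false] at h2
    rcases Nat.lt_succ_iff_lt_or_eq.1 h2 with h6 | h6
    · exact Or.inl (Or.inr ⟨i, h1, Or.inl h6⟩)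
    · subst h6
      rcases lt_trichotomy c.val T.pos with h7 | h7 | h7
      · exact Or.inl (Or.inr ⟨_, h1, Or.inr ⟨rfl, h7⟩⟩)
      · exact Or.inr (Or.inl ⟨h1, h7⟩)
      · exact Or.inr (Or.inr ⟨h1, h7, by omega⟩)

theorem Done.mem_arcs {p : Fin n × Fin n} {c : Fin n} (h : T.Done S p c) : p ∈ T.arcs S := by
  rcases h with h | ⟨i, h1, -⟩
  · exact Or.inl h
  · exact Or.inr (List.mem_of_getElem? h1)

theorem Le.getElem? {T T' : Trial n} (h : Le T T') {i : ℕ} (hi : i < T.queue.length) :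
    T'.queue[i]? = T.queue[i]? := by
  rw [List.getElem?_eq_getElem hi, List.getElem?_eq_getElem (hi.trans_le h.isPrefix.length_le),
    h.isPrefix.getElem hi]

theorem Le.done_iff {T T' : Trial n} (h : Le T T') (hlt : T.head < T.queue.length)
    {p : Fin n × Fin n} {c : Fin n} : T'.Done S p c ↔ T.Done S p c := by
  unfold Done
  refine or_congr_right (exists_congr fun i => ?_)
  rw [h.head, h.pos]
  refine and_congr_left fun hi => ?_
  rw [h.getElem? (by omega)]

/-- The state after one step of a running trial, in which the arc `p` is combined with `c`. -/
noncomputable def step (w : Fin n → Fin n → ℕ) (S : Set (Fin n × Fin n)) (p : Fin n × Fin n)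
    (c : Fin n) (T : Trial n) : Trial n :=
  ((T.scanHead w S p.1 p.2 c).scanTail w S p.1 p.2 c).advance

/-- The invariant is preserved by a step, in which the number of processed pairs grows by one. -/
theorem Inv.step (hT : Inv w S x T) (hw : ∀ a b, w a b = w b a) (h0 : ∀ a, w a a = 0)
    (hrun : T.status = 0) {p : Fin n × Fin n} {c : Fin n} (hp : T.queue[T.head]? = some p)
    (hc : c.val = T.pos) :
    Inv w S x (T.step w S p c) ∧
      n * (T.step w S p c).head + (T.step w S p c).pos = n * T.head + T.pos + 1 := by
  obtain ⟨a, b⟩ := p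
  have hmem : (a, b) ∈ T.queue := List.mem_of_getElem? hp
  have hpos : 0 < w a b := hT.pos _ hmem
  have hlt := hT.head_lt hrun
  obtain ⟨s2, l2, e2, y2⟩ := scan_spec (c := c) hT.toSound hw h0 (Or.inr hmem) hpos _ rfl
  unfold Trial.step
  generalize (T.scanHead w S a b c).scanTail w S a b c = T₂ at *
  have hpl := hT.pos_lt
  have hlen : T.queue.length ≤ T₂.queue.length := l2.isPrefix.length_le
  have hh := l2.head
  have hps := l2.pos
  have hst : T₂.status = 2 ∨ T₂.status = 0 := by rwa [hrun] at e2
  have hn : 0 < n := by omega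
  refine ⟨⟨s2.advance, ?_, ?_, ?_, ?_, ?_⟩, ?_⟩
  · unfold advance; split_ifs <;> simp only <;> omega
  · unfold advance; split_ifs with h1 h2
    · simp only; omega
    · simp
    · simp only
      intro h3
      have : ¬ (T₂.head + 1 = T₂.queue.length) := fun h4 => h2 ⟨h3, h4⟩
      omega
  · unfold advance; split_ifs with h1 h2
    · simp only; omega
    · simp only; exact fun _ => ⟨h2.2, trivial⟩
    · simp only; omega
  · unfold advance; split_ifs <;> simp only <;> omega
  · intro h2
    rw [Ne, status_advance_eq_two] at h2
    obtain ⟨yh, yt⟩ := y2 h2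
    have sat := hT.saturated (by omega)
    have hD : ∀ p' c', T₂.advance.Done S p' c' → T.Done S p' c' ∨ (p' = (a, b) ∧ c' = c) := by
      intro p' c' h
      rcases h.of_advance with h | ⟨h1, h3⟩ | ⟨h1, h3, h4⟩
      · exact Or.inl ((l2.done_iff hlt).1 h)
      · rw [l2.head, l2.getElem? (by omega), hp] at h1
        exact Or.inr ⟨(Option.some.inj h1).symm, Fin.ext (by omega)⟩
      · have := c'.isLt
        omega
    rw [arcs_advance]
    refine ⟨?_, ?_, ?_⟩
    · intro a' b' c' h h1 h3
      rcases hD _ _ h with h | ⟨h, rfl⟩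
      · exact l2.arcs (sat.head h h1 h3)
      · cases h
        exact yh (Or.inl ⟨h1, h3⟩)
    · intro a' b' c' h h1 h3 h4
      rcases hD _ _ h with h | ⟨h, rfl⟩
      · exact l2.arcs (sat.tail h h1 h3 h4)
      · cases h
        exact yt (Or.inl ⟨h1, h3, h4⟩)
    · intro a' b' c' h h' h1 h3
      rcases hD _ _ h with h | ⟨h, rfl⟩
      · rcases hD _ _ h' with h' | ⟨h', rfl⟩
        · exact l2.arcs (sat.trans h h' h1 h3)
        · cases h'
          have e1 := hw a a'
          have e2 := hw b a'
          exact yh (Or.inr ⟨by omega, by omega, h.mem_arcs⟩)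
      · cases h
        refine yt (Or.inr ⟨h1, h3, ?_⟩)
        rcases hD _ _ h' with h' | ⟨h', -⟩
        · exact h'.mem_arcs
        · rw [h']; exact Or.inr hmem
  · unfold advance
    split_ifs with h1 h2 <;> simp only
    · rw [hh, hps]; ring
    all_goals
      rw [hh]
      have : T.pos + 1 = n := by omega
      rw [mul_add, mul_one]; omega

theorem inv_start (hS : IsClosed w fun a b => (a, b) ∈ S) {a b : Fin n} (hne : a ≠ b)
    (hpos : 0 < w a b) (h1 : (a, b) ∉ S) (h2 : (b, a) ∉ S) : Inv w S (a, b) (start (a, b)) where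
  nodup := by simp [start]
  notMem := by simpa [start] using h1
  pos := by simpa [start] using hpos
  asymm := by
    intro p hp
    simp only [start, List.mem_singleton] at hp
    subst hp
    rintro (h | h)
    · exact h2 h
    · simp only [start, List.mem_singleton] at h
      exact hne (congrArg Prod.snd h)
  start_mem := by simp [start]
  forced := by
    intro O _ _ hx
    simpa [start] using hx
  pos_lt := (Nat.zero_le _).trans_lt a.isLt
  head_lt := by simp [start]
  finished := by simp [start]
  status_le := by simp [start]
  saturated := by
    intro _
    have hD : ∀ p c, (start (a, b)).Done S p c → p ∈ S := by
      rintro p c (h | ⟨i, -, h⟩)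
      · exact h
      · simp [start] at h
    exact ⟨fun h h1 h2 => Or.inl (hS.head (hD _ _ h) h1 h2),
      fun h h1 h2 h3 => Or.inl (hS.tail (hD _ _ h) h1 h2 h3),
      fun h h' h1 h2 => Or.inl (hS.trans (hD _ _ h) (hD _ _ h') h1 h2)⟩

/-- A trial that is completed without conflict yields a closed set of arcs. -/
theorem Inv.isClosed (hT : Inv w S x T) (hS : IsClosed w fun a b => (a, b) ∈ S)
    (hst : T.status = 1) : IsClosed w fun a b => (a, b) ∈ T.arcs S := by
  obtain ⟨h1, h2⟩ := hT.finished hst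
  have sat := hT.saturated (by omega)
  have hD : ∀ p c, p ∈ T.arcs S → T.Done S p c := by
    rintro p c (h | h)
    · exact Or.inl h
    · obtain ⟨i, hi, rfl⟩ := List.getElem_of_mem h
      exact Or.inr ⟨i, List.getElem?_eq_getElem hi, Or.inl (by omega)⟩
  refine ⟨?_, ?_, fun h => sat.head (hD _ _ h), fun h => sat.tail (hD _ _ h),
    fun h h' => sat.trans (hD _ _ h) (hD _ _ h')⟩
  · rintro a b (h | h)
    · exact hS.pos h
    · exact hT.pos _ h
  · rintro a b (h | h) h'
    · rcases h' with h' | h'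
      · exact hS.asymm h h'
      · exact hT.asymm _ h' (Or.inl h)
    · exact hT.asymm _ h h'

end Trial

/-! ### The program -/

/-- Several programs one after the other. -/
def block : List Program → Program
  | [] => .skip
  | p :: ps => .seq p (block ps)

/-- `x := v`. -/
def assign (x : ℕ) (v : Operand) : Program := .op .add x v (.const 0)

/-- `x := y * n + z`, the index of the pair `(y, z)`; register `0` holds `n`. -/
def pairIndex (x y z : ℕ) : Program :=
  .seq (.op .mul x (.reg y) (.reg 0)) (.op .add x (.reg x) (.reg z))

/-- The registers of the two trials: status (`k = 0`), position in the queue (`1`), length of the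
queue (`2`) and third vertex (`3`). -/
def treg (s : Bool) (k : ℕ) : ℕ := if s then 30 + k else 20 + k

/-- The arrays of the two trials: stamps (`k = 0`), tails (`1`) and heads (`2`) of the queue. The
stamp of an arc is at least the current stamp, kept in register `3`, if and only if the arc has been
decided. -/
def tarr (s : Bool) (k : ℕ) : ℕ := if s then 9 + k else 6 + k

/-- Record that the arc in registers `10`, `11` has been derived. -/
def forceProg (s : Bool) : Program :=
  block [pairIndex 8 10 11, .load 9 (tarr s 0) (.reg 8),
    .ite (.lt (.reg 9) (.reg 3))
      (block [pairIndex 17 11 10, .load 9 (tarr s 0) (.reg 17),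
        .ite (.lt (.reg 9) (.reg 3))
          (block [.store (tarr s 0) (.reg 8) (.reg 3),
            .store (tarr s 1) (.reg (treg s 2)) (.reg 10),
            .store (tarr s 2) (.reg (treg s 2)) (.reg 11),
            .op .add (treg s 2) (.reg (treg s 2)) (.const 1)])
          (assign (treg s 0) (.const 2))])
      .skip]

/-- Set register `19` to `1` if the three weights in registers `15`, `16`, `18` agree and the arc in
registers `x`, `y` is decided. -/
def triangleProg (s : Bool) (x y : ℕ) : Program :=
  .ite (.eq (.reg 15) (.reg 16))
    (.ite (.eq (.reg 18) (.reg 16))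
      (block [pairIndex 8 x y, .load 9 (tarr s 0) (.reg 8),
        .ite (.lt (.reg 9) (.reg 3)) .skip (assign 19 (.const 1))])
      .skip)
    .skip

/-- Set register `19` to `1` if the arc `(c, b)` can be derived, and to `0` otherwise; registers
`12`, `13`, `14` hold `a`, `b`, `c` and registers `15`, `16`, `18` the weights of `ab`, `bc`, `ac`.
-/
def flagHeadProg (s : Bool) : Program :=
  block [assign 19 (.const 0),
    .ite (.lt (.reg 16) (.reg 15)) .skip
      (.ite (.lt (.reg 18) (.reg 16)) (assign 19 (.const 1)) .skip),
    triangleProg s 14 12]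

/-- Set register `19` to `1` if the arc `(a, c)` can be derived, and to `0` otherwise. -/
def flagTailProg (s : Bool) : Program :=
  block [assign 19 (.const 0),
    .ite (.lt (.const 0) (.reg 18))
      (.ite (.lt (.reg 15) (.reg 18)) .skip
        (.ite (.lt (.reg 16) (.reg 15)) (assign 19 (.const 1)) .skip)) .skip,
    triangleProg s 13 14]

/-- If register `19` holds `1`, record the arc in registers `x`, `y`. -/
def forceIfProg (s : Bool) (x y : ℕ) : Program :=
  .ite (.eq (.reg 19) (.const 1))
    (.seq (.seq (assign 10 (.reg x)) (assign 11 (.reg y))) (forceProg s)) .skip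

/-- Load the current arc `(a, b)`, the third vertex `c`, and the three weights. -/
def loadProg (s : Bool) : Program :=
  block [.load 12 (tarr s 1) (.reg (treg s 1)), .load 13 (tarr s 2) (.reg (treg s 1)),
    assign 14 (.reg (treg s 3)),
    pairIndex 8 12 13, .load 15 5 (.reg 8),
    pairIndex 8 13 14, .load 16 5 (.reg 8),
    pairIndex 8 12 14, .load 18 5 (.reg 8)]

/-- Move on to the next third vertex, or to the next arc of the queue. -/
def advanceProg (s : Bool) : Program :=
  block [.op .add (treg s 3) (.reg (treg s 3)) (.const 1),
    .ite (.lt (.reg (treg s 3)) (.reg 0)) .skip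
      (block [assign (treg s 3) (.const 0), .op .add (treg s 1) (.reg (treg s 1)) (.const 1),
        .ite (.eq (.reg (treg s 0)) (.const 0))
          (.ite (.eq (.reg (treg s 1)) (.reg (treg s 2))) (assign (treg s 0) (.const 1)) .skip)
          .skip])]

/-- One step of a trial, if it is still running. -/
def stepProg (s : Bool) : Program :=
  .ite (.eq (.reg (treg s 0)) (.const 0))
    (block [loadProg s, flagHeadProg s, forceIfProg s 14 13, flagTailProg s, forceIfProg s 12 14,
      advanceProg s]) .skip

/-- Start the trial of the arc in registers `10`, `11`. -/
def startProg (s : Bool) : Program :=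
  block [pairIndex 8 10 11, .store (tarr s 0) (.reg 8) (.reg 3),
    .store (tarr s 1) (.const 0) (.reg 10), .store (tarr s 2) (.const 0) (.reg 11),
    assign (treg s 0) (.const 0), assign (treg s 1) (.const 0), assign (treg s 2) (.const 1),
    assign (treg s 3) (.const 0)]

/-- Clear register `6` if a trial has been completed without conflict or both have run into a
conflict. -/
def stopProg : Program :=
  block [.ite (.eq (.reg (treg false 0)) (.const 1)) (assign 6 (.const 0)) .skip,
    .ite (.eq (.reg (treg true 0)) (.const 1)) (assign 6 (.const 0)) .skip,
    .ite (.eq (.reg (treg false 0)) (.const 2))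
      (.ite (.eq (.reg (treg true 0)) (.const 2)) (assign 6 (.const 0)) .skip) .skip]

/-- Run both trials in parallel. -/
def raceProg : Program :=
  .while (.eq (.reg 6) (.const 1)) (block [stepProg false, stepProg true, stopProg])

/-- Make the decisions of a trial permanent. -/
def commitProg (s : Bool) : Program :=
  .seq (assign 41 (.const 0))
    (.while (.lt (.reg 41) (.reg (treg s 2)))
      (block [.load 10 (tarr s 1) (.reg 41), .load 11 (tarr s 2) (.reg 41), pairIndex 8 10 11,
        .store (tarr false 0) (.reg 8) (.reg 40), .store (tarr true 0) (.reg 8) (.reg 40),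
        .op .add 41 (.reg 41) (.const 1)]))

/-- Start the trial of the arc in registers `x`, `y`. -/
def tryProg (s : Bool) (x y : ℕ) : Program :=
  .seq (.seq (assign 10 (.reg x)) (assign 11 (.reg y))) (startProg s)

/-- Decide the edge in registers `4`, `5`. If this is impossible, clear register `7` and move on to
the last edge. -/
def decideProg : Program :=
  block [tryProg false 4 5, tryProg true 5 4, assign 6 (.const 1), raceProg,
    .ite (.eq (.reg (treg false 0)) (.const 1)) (commitProg false)
      (.ite (.eq (.reg (treg true 0)) (.const 1)) (commitProg true)
        (.seq (assign 7 (.const 0)) (assign 2 (.reg 1))))]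

/-- Write the decided orientation of the edge in registers `4`, `5`. -/
def outputProg : Program :=
  block [pairIndex 8 4 5, .load 9 (tarr false 0) (.reg 8),
    .ite (.eq (.reg 9) (.reg 40))
      (.seq (.store 3 (.reg 2) (.reg 4)) (.store 4 (.reg 2) (.reg 5)))
      (.seq (.store 3 (.reg 2) (.reg 5)) (.store 4 (.reg 2) (.reg 4)))]

/-- Load the edge whose number is in register `2`, together with the stamps of its orientations. -/
def fetchProg : Program :=
  block [.op .add 3 (.reg 2) (.const 1), .load 4 0 (.reg 2), .load 5 1 (.reg 2),
    pairIndex 8 4 5, .load 9 (tarr false 0) (.reg 8),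
    pairIndex 8 5 4, .load 17 (tarr false 0) (.reg 8)]

/-- Treat the edge whose number is in register `2`. -/
def edgeProg : Program :=
  block [fetchProg,
    .ite (.lt (.reg 9) (.reg 3)) (.ite (.lt (.reg 17) (.reg 3)) decideProg .skip) .skip,
    .seq outputProg (.op .add 2 (.reg 2) (.const 1))]

/-- Write the matrix of weights into array `5`. -/
def matrixProg : Program :=
  .while (.lt (.reg 2) (.reg 1))
    (block [.load 4 0 (.reg 2), .load 5 1 (.reg 2), .load 9 2 (.reg 2),
      .op .add 9 (.reg 9) (.const 1), pairIndex 8 4 5, .store 5 (.reg 8) (.reg 9),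
      pairIndex 8 5 4, .store 5 (.reg 8) (.reg 9), .op .add 2 (.reg 2) (.const 1)])

/-- The whole algorithm. Register `2` is the number of the current edge, `3` the current stamp, `4`
and `5` hold the current edge; `7` holds the answer, and `40` the stamp `m + 1` of permanent
decisions. Array `5` holds the weights; arrays `0` to `2` are the input, `3` and `4` the output. -/
def orientProg : Program :=
  block [.op .add 40 (.reg 1) (.const 1), assign 7 (.const 1), assign 2 (.const 0), matrixProg,
    assign 2 (.const 0), .while (.lt (.reg 2) (.reg 1)) edgeProg, assign 0 (.reg 7)]

/-! ### The representation of a trial in memory -/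

theorem pair_index_inj {n : ℕ} {x y x' y' : Fin n} (h : (x : ℕ) * n + y = x' * n + y') :
    x = x' ∧ y = y' := by
  have hn : 0 < n := x.pos
  have h1 : ((x : ℕ) * n + y) / n = x := by
    rw [mul_comm, Nat.mul_add_div hn, Nat.div_eq_of_lt y.isLt, add_zero]
  have h2 : ((x' : ℕ) * n + y') / n = x' := by
    rw [mul_comm, Nat.mul_add_div hn, Nat.div_eq_of_lt y'.isLt, add_zero]
  have h3 : (x : ℕ) = x' := by rw [← h1, ← h2, h]
  refine ⟨Fin.ext h3, Fin.ext ?_⟩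
  rw [h3] at h; omega

theorem pair_index_lt {n : ℕ} (x y : Fin n) : (x : ℕ) * n + y < n * n := by
  have := y.isLt
  calc (x : ℕ) * n + y < x * n + n := by omega
    _ = (x + 1) * n := by ring
    _ ≤ n * n := Nat.mul_le_mul_right _ x.isLt

/-- The parts of the memory that stay fixed while an edge is being decided. -/
structure Env {n : ℕ} (m stamp : ℕ) (w : Fin n → Fin n → ℕ) (σ : Store) : Prop where
  reg_n : σ.reg 0 = n
  reg_m : σ.reg 1 = m
  reg_stamp : σ.reg 3 = stamp
  reg_big : σ.reg 40 = m + 1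
  weight : ∀ x y : Fin n, σ.arr 5 (x * n + y) = w x y

/-- The memory represents the trial `T`. The permanent decisions `S` carry the stamp `m + 1`. -/
structure Rep {n : ℕ} (m stamp : ℕ) (S : Set (Fin n × Fin n)) (s : Bool) (T : Trial n)
    (σ : Store) : Prop where
  status : σ.reg (treg s 0) = T.status
  head : σ.reg (treg s 1) = T.head
  length : σ.reg (treg s 2) = T.queue.length
  pos : σ.reg (treg s 3) = T.pos
  tails : ∀ i p, T.queue[i]? = some p → σ.arr (tarr s 1) i = p.1
  heads : ∀ i p, T.queue[i]? = some p → σ.arr (tarr s 2) i = p.2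
  decided : ∀ x y, (x, y) ∈ T.arcs S ↔ stamp ≤ σ.arr (tarr s 0) (x * n + y)
  stamp_le : ∀ x y, (x, y) ∉ S → σ.arr (tarr s 0) (x * n + y) ≤ stamp
  big : ∀ x y, (x, y) ∈ S → σ.arr (tarr s 0) (x * n + y) = m + 1

section

variable {n m stamp W : ℕ} {w : Fin n → Fin n → ℕ} {S : Set (Fin n × Fin n)} {s : Bool}
  {T : Trial n} {σ σ' : Store}

theorem Env.congr (h : Env m stamp w σ) (h0 : ∀ x ∈ [0, 1, 3, 40], σ'.reg x = σ.reg x)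
    (h1 : σ'.arr 5 = σ.arr 5) : Env m stamp w σ' where
  reg_n := (h0 0 (by simp)).trans h.reg_n
  reg_m := (h0 1 (by simp)).trans h.reg_m
  reg_stamp := (h0 3 (by simp)).trans h.reg_stamp
  reg_big := (h0 40 (by simp)).trans h.reg_big
  weight := by rw [h1]; exact h.weight

/-- The registers of a trial may change if the queue stays the same. -/
theorem Rep.update (h : Rep m stamp S s T σ) {T' : Trial n} (hq : T'.queue = T.queue)
    (h0 : σ'.reg (treg s 0) = T'.status) (h1 : σ'.reg (treg s 1) = T'.head)
    (h2 : σ'.reg (treg s 2) = σ.reg (treg s 2)) (h3 : σ'.reg (treg s 3) = T'.pos)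
    (h4 : ∀ k ∈ [0, 1, 2], σ'.arr (tarr s k) = σ.arr (tarr s k)) : Rep m stamp S s T' σ' where
  status := h0
  head := h1
  length := by rw [hq, h2, h.length]
  pos := h3
  tails := by rw [h4 1 (by simp), hq]; exact h.tails
  heads := by rw [h4 2 (by simp), hq]; exact h.heads
  decided := by
    have : T'.arcs S = T.arcs S := by unfold Trial.arcs; rw [hq]
    rw [h4 0 (by simp), this]; exact h.decided
  stamp_le := by rw [h4 0 (by simp)]; exact h.stamp_le
  big := by rw [h4 0 (by simp)]; exact h.big

theorem Rep.congr (h : Rep m stamp S s T σ)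
    (h0 : ∀ k ∈ [0, 1, 2, 3], σ'.reg (treg s k) = σ.reg (treg s k))
    (h1 : ∀ k ∈ [0, 1, 2], σ'.arr (tarr s k) = σ.arr (tarr s k)) : Rep m stamp S s T σ' where
  status := (h0 0 (by simp)).trans h.status
  head := (h0 1 (by simp)).trans h.head
  length := (h0 2 (by simp)).trans h.length
  pos := (h0 3 (by simp)).trans h.pos
  tails := by rw [h1 1 (by simp)]; exact h.tails
  heads := by rw [h1 2 (by simp)]; exact h.heads
  decided := by rw [h1 0 (by simp)]; exact h.decided
  stamp_le := by rw [h1 0 (by simp)]; exact h.stamp_le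
  big := by rw [h1 0 (by simp)]; exact h.big

/-- Two stores that agree on everything a trial uses, except that an arc has been appended to the
queue. -/
theorem Rep.push (h : Rep m stamp S s T σ) {x y : Fin n} (h1 : (x, y) ∉ T.arcs S)
    (h0 : ∀ k ∈ [0, 1, 3], σ'.reg (treg s k) = σ.reg (treg s k))
    (hl : σ'.reg (treg s 2) = T.queue.length + 1)
    (ha : σ'.arr (tarr s 0) = Function.update (σ.arr (tarr s 0)) (x * n + y) stamp)
    (hb : σ'.arr (tarr s 1) = Function.update (σ.arr (tarr s 1)) T.queue.length x)
    (hc : σ'.arr (tarr s 2) = Function.update (σ.arr (tarr s 2)) T.queue.length y) :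
    Rep m stamp S s { T with queue := T.queue ++ [(x, y)] } σ' := by
  have hq : ∀ i p, (T.queue ++ [(x, y)])[i]? = some p →
      (i = T.queue.length ∧ p = (x, y)) ∨ (i ≠ T.queue.length ∧ T.queue[i]? = some p) := by
    intro i p hi
    rcases lt_trichotomy i T.queue.length with h2 | h2 | h2
    · rw [List.getElem?_append_left h2] at hi
      exact Or.inr ⟨h2.ne, hi⟩
    · subst h2
      rw [List.getElem?_concat_length] at hi
      exact Or.inl ⟨rfl, (Option.some.inj hi).symm⟩
    · rw [List.getElem?_eq_none (by simp; omega)] at hi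
      cases hi
  have hu : ∀ x' y' : Fin n, (x, y) ≠ (x', y') →
      σ'.arr (tarr s 0) (x' * n + y') = σ.arr (tarr s 0) (x' * n + y') := by
    intro x' y' h2
    rw [ha, Function.update_of_ne]
    intro h3
    obtain ⟨rfl, rfl⟩ := pair_index_inj h3
    exact h2 rfl
  have hxy : σ'.arr (tarr s 0) (x * n + y) = stamp := by rw [ha, Function.update_self]
  refine ⟨(h0 0 (by simp)).trans h.status, (h0 1 (by simp)).trans h.head, by simpa using hl,
    (h0 3 (by simp)).trans h.pos, fun i p hi => ?_, fun i p hi => ?_, fun x' y' => ?_,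
    fun x' y' h2 => ?_, fun x' y' h2 => ?_⟩
  · rcases hq i p hi with ⟨rfl, rfl⟩ | ⟨h2, h3⟩
    · rw [hb, Function.update_self]
    · rw [hb, Function.update_of_ne h2]
      exact h.tails i p h3
  · rcases hq i p hi with ⟨rfl, rfl⟩ | ⟨h2, h3⟩
    · rw [hc, Function.update_self]
    · rw [hc, Function.update_of_ne h2]
      exact h.heads i p h3
  · by_cases h2 : (x, y) = (x', y')
    · cases h2
      rw [hxy]
      simp [Trial.arcs]
    · rw [hu x' y' h2, ← h.decided x' y']
      have h3 : ¬ (x' = x ∧ y' = y) := fun h3 => h2 (by rw [h3.1, h3.2])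
      simp [Trial.arcs, h3]
  · by_cases h3 : (x, y) = (x', y')
    · cases h3
      exact hxy.le
    · rw [hu x' y' h3]
      exact h.stamp_le x' y' h2
  · rw [hu x' y' fun h3 => h1 (Or.inl (by rw [h3]; exact h2))]
    exact h.big x' y' h2

end

theorem reg_ite (c : Prop) [Decidable c] (σ τ : Store) (x : ℕ) :
    (if c then σ else τ).reg x = if c then σ.reg x else τ.reg x := by split_ifs <;> rfl

theorem arr_ite (c : Prop) [Decidable c] (σ τ : Store) (x : ℕ) :
    (if c then σ else τ).arr x = if c then σ.arr x else τ.arr x := by split_ifs <;> rfl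

-- with these rules, `simp` evaluates `run p σ` and `Fits W p σ` symbolically
attribute [local simp] block pairIndex assign Fits run Store.setReg Store.setArr Operand.val
  BinOp.eval Test.Holds reg_ite arr_ite

section

variable {n m stamp W : ℕ} {w : Fin n → Fin n → ℕ} {S : Set (Fin n × Fin n)} {s : Bool}
  {T : Trial n} {σ σ' : Store}

theorem runs_forceProg (hE : Env m stamp w σ) (hR : Rep m stamp S s T σ) (hW : n * n + 2 ≤ W)
    (hq : T.queue.length + 1 ≤ W) {x y : Fin n} (hx : σ.reg 10 = x) (hy : σ.reg 11 = y) :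
    Runs W (forceProg s) σ (cost (forceProg s)) fun σ' =>
      Rep m stamp S s (T.force S x y) σ' := by
  have b1 := pair_index_lt x y
  have b2 := pair_index_lt y x
  have d1 := hR.decided x y
  have d2 := hR.decided y x
  have hl := hR.length
  refine (runs_of_fits _ _ ?_).mono le_rfl ?_
  · cases s <;> simp [forceProg, treg, tarr, hE.reg_n, hx, hy, hE.reg_stamp] at hl ⊢ <;> omega
  · rintro σ' rfl
    unfold Trial.force
    split_ifs with h1 h2
    · have h1' := d1.1 h1
      cases s <;> simp [tarr] at h1' <;> refine hR.congr ?_ ?_ <;>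
      simp [forceProg, treg, tarr, hE.reg_n, hx, hy, hE.reg_stamp, h1'.not_gt]
    · rw [d1, not_le] at h1
      have h2' := d2.1 h2
      have e0 := hR.head
      have e1 := hR.pos
      cases s <;> simp [tarr, treg] at h1 h2' e0 e1 hl
      all_goals
        refine hR.update rfl ?_ ?_ ?_ ?_ ?_ <;>
        simp [forceProg, treg, tarr, hE.reg_n, hx, hy, hE.reg_stamp, h1, h2'.not_gt, e0, e1, hl]
    · have h1' := h1
      have h2' := h2
      rw [d1, not_le] at h1'
      rw [d2, not_le] at h2'
      cases s <;> simp [tarr, treg] at h1' h2' hl <;> refine hR.push h1 ?_ ?_ ?_ ?_ ?_ <;>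
      simp [forceProg, treg, tarr, hE.reg_n, hx, hy, hE.reg_stamp, h1', h2', hl]

/-- The registers hold an arc `(a, b)`, a third vertex `c`, and the weights of the three pairs. -/
structure Cur (w : Fin n → Fin n → ℕ) (a b c : Fin n) (σ : Store) : Prop where
  reg_a : σ.reg 12 = a
  reg_b : σ.reg 13 = b
  reg_c : σ.reg 14 = c
  weight_ab : σ.reg 15 = w a b
  weight_bc : σ.reg 16 = w b c
  weight_ac : σ.reg 18 = w a c

theorem Cur.congr {a b c : Fin n} (h : Cur w a b c σ)
    (h0 : ∀ x ∈ [12, 13, 14, 15, 16, 18], σ'.reg x = σ.reg x) : Cur w a b c σ' where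
  reg_a := (h0 12 (by simp)).trans h.reg_a
  reg_b := (h0 13 (by simp)).trans h.reg_b
  reg_c := (h0 14 (by simp)).trans h.reg_c
  weight_ab := (h0 15 (by simp)).trans h.weight_ab
  weight_bc := (h0 16 (by simp)).trans h.weight_bc
  weight_ac := (h0 18 (by simp)).trans h.weight_ac

theorem runs_loadProg (hE : Env m stamp w σ) (hR : Rep m stamp S s T σ) (hW : n * n + n + 2 ≤ W)
    {p : Fin n × Fin n} {c : Fin n} (hp : T.queue[T.head]? = some p) (hc : c.val = T.pos) :
    Runs W (loadProg s) σ (cost (loadProg s)) (Cur w p.1 p.2 c) := by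
  have b1 := pair_index_lt p.1 p.2
  have b2 := pair_index_lt p.2 c
  have b3 := pair_index_lt p.1 c
  have l1 := c.isLt
  have e1 := hR.tails _ _ hp
  have e2 := hR.heads _ _ hp
  have e3 := hR.head
  have e4 := hR.pos
  rw [← hc] at e4
  have w1 := hE.weight p.1 p.2
  have w2 := hE.weight p.2 c
  have w3 := hE.weight p.1 c
  refine (runs_of_fits _ _ ?_).mono le_rfl ?_
  · cases s <;> simp [treg, tarr] at e1 e2 e3 e4 <;>
    simp [loadProg, treg, tarr, hE.reg_n, e1, e2, e3, e4] <;> omega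
  · rintro σ' rfl
    cases s <;> simp [treg, tarr] at e1 e2 e3 e4 <;> constructor <;>
    simp [loadProg, treg, tarr, hE.reg_n, e1, e2, e3, e4, w1, w2, w3]

theorem runs_flagHeadProg (hE : Env m stamp w σ) (hR : Rep m stamp S s T σ) (hW : n * n + 2 ≤ W)
    {a b c : Fin n} (hC : Cur w a b c σ) :
    Runs W (flagHeadProg s) σ (cost (flagHeadProg s)) fun σ' =>
      (σ'.reg 19 = 1 ↔ Trial.YieldsHead w (T.arcs S) a b c) := by
  have b1 := pair_index_lt c a
  have d1 := hR.decided c a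
  refine (runs_of_fits _ _ ?_).mono le_rfl ?_
  · cases s <;>
    simp [flagHeadProg, triangleProg, tarr, hE.reg_n, hE.reg_stamp, hC.reg_a, hC.reg_b, hC.reg_c,
      hC.weight_ab, hC.weight_bc, hC.weight_ac] <;> omega
  · rintro σ' rfl
    rw [Trial.YieldsHead, d1]
    cases s <;>
    simp [flagHeadProg, triangleProg, tarr, hE.reg_n, hE.reg_stamp, hC.reg_a, hC.reg_b, hC.reg_c,
      hC.weight_ab, hC.weight_bc, hC.weight_ac] <;> split_ifs <;> simp <;> omega

theorem runs_flagTailProg (hE : Env m stamp w σ) (hR : Rep m stamp S s T σ) (hW : n * n + 2 ≤ W)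
    {a b c : Fin n} (hC : Cur w a b c σ) :
    Runs W (flagTailProg s) σ (cost (flagTailProg s)) fun σ' =>
      (σ'.reg 19 = 1 ↔ Trial.YieldsTail w (T.arcs S) a b c) := by
  have b1 := pair_index_lt b c
  have d1 := hR.decided b c
  refine (runs_of_fits _ _ ?_).mono le_rfl ?_
  · cases s <;>
    simp [flagTailProg, triangleProg, tarr, hE.reg_n, hE.reg_stamp, hC.reg_a, hC.reg_b, hC.reg_c,
      hC.weight_ab, hC.weight_bc, hC.weight_ac] <;> omega
  · rintro σ' rfl
    rw [Trial.YieldsTail, d1]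
    cases s <;>
    simp [flagTailProg, triangleProg, tarr, hE.reg_n, hE.reg_stamp, hC.reg_a, hC.reg_b, hC.reg_c,
      hC.weight_ab, hC.weight_bc, hC.weight_ac] <;> split_ifs <;> simp <;> omega

end

/-! ### One step of a trial -/

section

variable {n m stamp W : ℕ} {w : Fin n → Fin n → ℕ} {S : Set (Fin n × Fin n)} {s : Bool}
  {T : Trial n} {σ σ' : Store}

/-- The program `p`, run with initial memory `σ` and final memory `σ'`, has changed only what it
may change. -/
def Framed (p : Program) (σ σ' : Store) : Prop :=
  (∀ x ∉ regsOf p, σ'.reg x = σ.reg x) ∧ ∀ A ∉ arrsOf p, σ'.arr A = σ.arr A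

theorem Env.frame {p : Program} (h : Env m stamp w σ) (hf : Framed p σ σ')
    (h0 : ∀ x ∈ [0, 1, 3, 40], x ∉ regsOf p) (h1 : 5 ∉ arrsOf p) : Env m stamp w σ' :=
  h.congr (fun x hx => hf.1 x (h0 x hx)) (hf.2 5 h1)

theorem Rep.frame {p : Program} (h : Rep m stamp S s T σ) (hf : Framed p σ σ')
    (h0 : ∀ k ∈ [0, 1, 2, 3], treg s k ∉ regsOf p) (h1 : ∀ k ∈ [0, 1, 2], tarr s k ∉ arrsOf p) :
    Rep m stamp S s T σ' :=
  h.congr (fun k hk => hf.1 _ (h0 k hk)) fun k hk => hf.2 _ (h1 k hk)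

theorem Cur.frame {p : Program} {a b c : Fin n} (h : Cur w a b c σ) (hf : Framed p σ σ')
    (h0 : ∀ x ∈ [12, 13, 14, 15, 16, 18], x ∉ regsOf p) : Cur w a b c σ' :=
  h.congr fun x hx => hf.1 x (h0 x hx)

theorem runs_forceIfProg {P : Prop} [Decidable P] (hE : Env m stamp w σ)
    (hR : Rep m stamp S s T σ) (hW : n * n + n + 2 ≤ W) (hq : T.queue.length + 1 ≤ W)
    (hP : σ.reg 19 = 1 ↔ P) {x y : Fin n} {rx ry : ℕ} (hx : σ.reg rx = x) (hy : σ.reg ry = y)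
    (hry : ry ≠ 10) :
    Runs W (forceIfProg s rx ry) σ (cost (forceIfProg s rx ry)) fun σ' =>
      Rep m stamp S s (if P then T.force S x y else T) σ' := by
  have l1 := x.isLt
  have l2 := y.isLt
  refine (Runs.ite (T := cost (forceProg s) + 2) (fun h => ?_) fun h => ?_).mono
    (by simp only [cost, forceIfProg, assign]; omega) fun σ' h => h
  · simp only [Test.Holds, Operand.val, hP] at h
    rw [if_pos h]
    refine ((Runs.frame (runs_of_fits (.seq (assign 10 (.reg rx)) (assign 11 (.reg ry))) σ ?_)).seq
      (U := cost (forceProg s)) ?_).mono (by simp only [cost, assign]; omega) fun σ' h => h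
    · simp [hx, hy, hry]; omega
    · rintro σ' ⟨rfl, hf⟩
      refine runs_forceProg (hE.frame hf (by simp [regsOf]) (by simp [arrsOf]))
        (hR.frame hf (by cases s <;> simp [regsOf, treg]) (by cases s <;> simp [arrsOf]))
        (by omega) (by omega) ?_ ?_
      · simp [hx]
      · simp [hy, hry]
  · simp only [Test.Holds, Operand.val, hP] at h
    rw [if_neg h]
    exact ⟨1, σ, .skip σ, by omega, hR⟩

theorem runs_advanceProg (hE : Env m stamp w σ) (hR : Rep m stamp S s T σ) (hW : n + 1 ≤ W)
    (hpos : T.pos < n) (hh : T.head + 1 ≤ W) :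
    Runs W (advanceProg s) σ (cost (advanceProg s)) fun σ' => Rep m stamp S s T.advance σ' := by
  have e0 := hR.status
  have e1 := hR.head
  have e2 := hR.length
  have e3 := hR.pos
  refine (runs_of_fits _ _ ?_).mono le_rfl ?_
  · cases s <;> simp [treg] at e0 e1 e2 e3 <;>
    simp [advanceProg, treg, hE.reg_n, e0, e1, e2, e3] <;> omega
  · rintro σ' rfl
    unfold Trial.advance
    split_ifs with h1 h2
    · cases s <;> simp [treg] at e0 e1 e2 e3 <;> refine hR.update rfl ?_ ?_ ?_ ?_ ?_ <;>
      simp [advanceProg, treg, tarr, hE.reg_n, e0, e1, e2, e3, h1]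
    · obtain ⟨h3, h4⟩ := h2
      cases s <;> simp [treg] at e0 e1 e2 e3 <;> refine hR.update rfl ?_ ?_ ?_ ?_ ?_ <;>
      simp [advanceProg, treg, tarr, hE.reg_n, e0, e1, e2, e3, h1, h3, h4]
    · have h3 : T.status = 0 → ¬ (T.head + 1 = T.queue.length) := fun h3 h4 => h2 ⟨h3, h4⟩
      by_cases h4 : T.status = 0
      · have h5 := h3 h4
        cases s <;> simp [treg] at e0 e1 e2 e3 <;> refine hR.update rfl ?_ ?_ ?_ ?_ ?_ <;>
        simp [advanceProg, treg, tarr, hE.reg_n, e0, e1, e2, e3, h1, h4, h5]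
      · cases s <;> simp [treg] at e0 e1 e2 e3 <;> refine hR.update rfl ?_ ?_ ?_ ?_ ?_ <;>
        simp [advanceProg, treg, tarr, hE.reg_n, e0, e1, e2, e3, h1, h4]

/-- One step of a running trial. -/
theorem runs_stepProg (hE : Env m stamp w σ) (hR : Rep m stamp S s T σ)
    (hW : n * n + n + 2 ≤ W) (hq : T.queue.length + 2 ≤ W) (hst : T.status = 0)
    {p : Fin n × Fin n} {c : Fin n} (hp : T.queue[T.head]? = some p) (hc : c.val = T.pos) :
    Runs W (stepProg s) σ (cost (stepProg s)) fun σ' => Rep m stamp S s (T.step w S p c) σ' := by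
  classical
  have hlen : ∀ (T : Trial n) (x y : Fin n), (T.force S x y).queue.length ≤ T.queue.length + 1 := by
    intro T x y
    unfold Trial.force
    split_ifs <;> simp
  have hhd : ∀ (T : Trial n) (x y : Fin n), (T.force S x y).head = T.head ∧
      (T.force S x y).pos = T.pos := fun T x y =>
    ⟨(Trial.le_force x y).head, (Trial.le_force x y).pos⟩
  have hhead : T.head < T.queue.length := (List.getElem?_eq_some_iff.1 hp).1
  have hcn := c.isLt
  refine (Runs.ite (T := cost (loadProg s) + (cost (flagHeadProg s) + (cost (forceIfProg s 14 13) +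
    (cost (flagTailProg s) + (cost (forceIfProg s 12 14) + (cost (advanceProg s) + 1))))))
    (fun _ => ?_) fun h => ?_).mono (by simp only [cost, stepProg, block]; omega) fun σ' h => h
  · refine (runs_loadProg hE hR (by omega) hp hc).frame.seq fun σ₁ ⟨hC₁, hf₁⟩ => ?_
    have hE₁ := hE.frame hf₁ (by cases s <;> decide) (by cases s <;> decide)
    have hR₁ := hR.frame hf₁ (by cases s <;> decide) (by cases s <;> decide)
    refine (runs_flagHeadProg hE₁ hR₁ (by omega) hC₁).frame.seq fun σ₂ ⟨hY₂, hf₂⟩ => ?_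
    have hE₂ := hE₁.frame hf₂ (by cases s <;> decide) (by cases s <;> decide)
    have hR₂ := hR₁.frame hf₂ (by cases s <;> decide) (by cases s <;> decide)
    have hC₂ := hC₁.frame hf₂ (by cases s <;> decide)
    refine (runs_forceIfProg hE₂ hR₂ hW (by omega) hY₂ hC₂.reg_c hC₂.reg_b (by decide)).frame.seq
      fun σ₃ ⟨hR₃, hf₃⟩ => ?_
    have hE₃ := hE₂.frame hf₃ (by cases s <;> decide) (by cases s <;> decide)
    have hC₃ := hC₂.frame hf₃ (by cases s <;> decide)
    have hT₁ : (if Trial.YieldsHead w (T.arcs S) p.1 p.2 c then T.force S c p.2 else T) =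
      T.scanHead w S p.1 p.2 c := by unfold Trial.scanHead; congr
    rw [hT₁] at hR₃
    have q₁ : (T.scanHead w S p.1 p.2 c).queue.length ≤ T.queue.length + 1 ∧
        (T.scanHead w S p.1 p.2 c).head = T.head ∧ (T.scanHead w S p.1 p.2 c).pos = T.pos := by
      unfold Trial.scanHead
      split_ifs
      · exact ⟨hlen _ _ _, hhd _ _ _⟩
      · exact ⟨by omega, rfl, rfl⟩
    unfold Trial.step
    generalize T.scanHead w S p.1 p.2 c = T₁ at *
    refine (runs_flagTailProg hE₃ hR₃ (by omega) hC₃).frame.seq fun σ₄ ⟨hY₄, hf₄⟩ => ?_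
    have hE₄ := hE₃.frame hf₄ (by cases s <;> decide) (by cases s <;> decide)
    have hR₄ := hR₃.frame hf₄ (by cases s <;> decide) (by cases s <;> decide)
    have hC₄ := hC₃.frame hf₄ (by cases s <;> decide)
    refine (runs_forceIfProg hE₄ hR₄ hW (by omega) hY₄ hC₄.reg_a hC₄.reg_c (by decide)).frame.seq
      fun σ₅ ⟨hR₅, hf₅⟩ => ?_
    have hE₅ := hE₄.frame hf₅ (by cases s <;> decide) (by cases s <;> decide)
    have hT₂ : (if Trial.YieldsTail w (T₁.arcs S) p.1 p.2 c then T₁.force S p.1 c else T₁) =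
      T₁.scanTail w S p.1 p.2 c := by unfold Trial.scanTail; congr
    rw [hT₂] at hR₅
    have q₂ : (T₁.scanTail w S p.1 p.2 c).head = T₁.head ∧
        (T₁.scanTail w S p.1 p.2 c).pos = T₁.pos := by
      unfold Trial.scanTail
      split_ifs
      · exact hhd _ _ _
      · exact ⟨rfl, rfl⟩
    generalize T₁.scanTail w S p.1 p.2 c = T₂ at *
    refine (runs_advanceProg hE₅ hR₅ (by omega) (by omega) (by omega)).seq fun σ₆ hR₆ => ?_
    exact ⟨1, σ₆, .skip σ₆, le_rfl, hR₆⟩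
  · exact absurd (hR.status.trans hst) h

/-- A trial that is not running is left alone. -/
theorem runs_stepProg_of_ne (hR : Rep m stamp S s T σ) (hst : T.status ≠ 0) :
    Runs W (stepProg s) σ (cost (stepProg s)) fun σ' => Rep m stamp S s T σ' := by
  refine (Runs.ite (T := 1) (fun h => ?_) fun _ => ?_).mono
    (by simp only [cost, stepProg]; omega) fun σ' h => h
  · exact absurd (hR.status.symm.trans h) hst
  · exact ⟨1, σ, .skip σ, le_rfl, hR⟩

end

/-! ### The race between two trials -/

/-- Between two trials: the permanent decisions `S` carry the stamp `m + 1`, and all other stamps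
are out of date. -/
structure Idle {n : ℕ} (m stamp : ℕ) (S : Set (Fin n × Fin n)) (s : Bool) (σ : Store) : Prop where
  big : ∀ x y, (x, y) ∈ S → σ.arr (tarr s 0) (x * n + y) = m + 1
  lt : ∀ x y, (x, y) ∉ S → σ.arr (tarr s 0) (x * n + y) < stamp

section

variable {n m stamp W : ℕ} {w : Fin n → Fin n → ℕ} {S : Set (Fin n × Fin n)} {s : Bool}
  {σ σ' : Store}

theorem Idle.frame {p : Program} (h : Idle m stamp S s σ) (hf : Framed p σ σ')
    (h0 : tarr s 0 ∉ arrsOf p) : Idle m stamp S s σ' := by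
  have := hf.2 _ h0
  exact ⟨by rw [this]; exact h.big, by rw [this]; exact h.lt⟩

theorem runs_startProg (hE : Env m stamp w σ) (hI : Idle m stamp S s σ) (hstamp : stamp ≤ m + 1)
    (hW : n * n + 2 ≤ W) {x y : Fin n} (hx : σ.reg 10 = x) (hy : σ.reg 11 = y)
    (hxy : (x, y) ∉ S) :
    Runs W (startProg s) σ (cost (startProg s)) fun σ' =>
      Rep m stamp S s (Trial.start (x, y)) σ' := by
  have b1 := pair_index_lt x y
  refine (runs_of_fits _ _ ?_).mono le_rfl ?_
  · cases s <;> simp [startProg, treg, tarr, hE.reg_n, hE.reg_stamp, hx, hy] <;> omega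
  · rintro σ' rfl
    have ha : (run (startProg s) σ).arr (tarr s 0) =
        Function.update (σ.arr (tarr s 0)) (x * n + y) stamp := by
      cases s <;> simp [startProg, treg, tarr, hE.reg_n, hE.reg_stamp, hx, hy]
    have hu : ∀ x' y' : Fin n, (x, y) ≠ (x', y') →
        (run (startProg s) σ).arr (tarr s 0) (x' * n + y') = σ.arr (tarr s 0) (x' * n + y') := by
      intro x' y' h2
      rw [ha, Function.update_of_ne]
      intro h3
      obtain ⟨rfl, rfl⟩ := pair_index_inj h3
      exact h2 rfl
    have hs : (run (startProg s) σ).arr (tarr s 0) (x * n + y) = stamp := by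
      rw [ha, Function.update_self]
    refine ⟨?_, ?_, ?_, ?_, ?_, ?_, ?_, ?_, ?_⟩
    · cases s <;> simp [startProg, treg, Trial.start]
    · cases s <;> simp [startProg, treg, Trial.start]
    · cases s <;> simp [startProg, treg, Trial.start]
    · cases s <;> simp [startProg, treg, Trial.start]
    · intro i p hp
      obtain ⟨h1, h2⟩ := List.getElem?_eq_some_iff.1 hp
      simp only [Trial.start, List.length_singleton, Nat.lt_one_iff] at h1
      subst h1
      subst h2
      cases s <;> simp [startProg, treg, tarr, Trial.start, hx, hy]
    · intro i p hp
      obtain ⟨h1, h2⟩ := List.getElem?_eq_some_iff.1 hp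
      simp only [Trial.start, List.length_singleton, Nat.lt_one_iff] at h1
      subst h1
      subst h2
      cases s <;> simp [startProg, treg, tarr, Trial.start, hx, hy]
    · intro x' y'
      by_cases h2 : (x, y) = (x', y')
      · cases h2
        rw [hs]
        simp [Trial.arcs, Trial.start]
      · have h3 : (x', y') ∈ (Trial.start (x, y)).arcs S ↔ (x', y') ∈ S := by
          have : ¬ (x' = x ∧ y' = y) := fun h4 => h2 (by rw [h4.1, h4.2])
          simp [Trial.arcs, Trial.start, this]
        rw [h3, hu x' y' h2]
        by_cases h4 : (x', y') ∈ S
        · have := hI.big x' y' h4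
          simp [h4]; omega
        · have := hI.lt x' y' h4
          simp [h4, this]
    · intro x' y' h2
      by_cases h3 : (x, y) = (x', y')
      · cases h3
        exact hs.le
      · rw [hu x' y' h3]
        exact (hI.lt x' y' h2).le
    · intro x' y' h2
      rw [hu x' y' fun h3 => hxy (by rw [h3]; exact h2)]
      exact hI.big x' y' h2

/-- Some trial has been completed without conflict, or both have run into a conflict. -/
def Stopped (T : Bool → Trial n) : Prop :=
  (T false).status = 1 ∨ (T true).status = 1 ∨ ((T false).status = 2 ∧ (T true).status = 2)

/-- The invariant of the race between the trials of the arcs `x false` and `x true`, after `j`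
rounds. -/
structure Race (m stamp : ℕ) (w : Fin n → Fin n → ℕ) (S : Set (Fin n × Fin n))
    (x : Bool → Fin n × Fin n) (T : Bool → Trial n) (j : ℕ) (σ : Store) : Prop where
  env : Env m stamp w σ
  rep : ∀ s, Rep m stamp S s (T s) σ
  inv : ∀ s, Trial.Inv w S (x s) (T s)
  round : ∀ s, (T s).status ≠ 2 → n * (T s).head + (T s).pos = j
  le : j ≤ n * m

theorem cost_stepProg : cost (stepProg s) ≤ 150 := by cases s <;> decide

/-- One round of a single trial that has not been completed. -/
theorem runs_stepProg_round {T : Trial n} {x : Fin n × Fin n} {j : ℕ}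
    (hw : ∀ a b, w a b = w b a) (h0 : ∀ a, w a a = 0)
    (hE : Env m stamp w σ) (hR : Rep m stamp S s T σ) (hI : Trial.Inv w S x T)
    (hW : n * n + n + 2 ≤ W) (hq : T.queue.length + 2 ≤ W)
    (hj : T.status ≠ 2 → n * T.head + T.pos = j) (hst : T.status ≠ 1) :
    ∃ T', Runs W (stepProg s) σ 150 (fun σ' => Rep m stamp S s T' σ') ∧ Trial.Inv w S x T' ∧
      (T'.status ≠ 2 → n * T'.head + T'.pos = j + 1) := by
  by_cases h : T.status = 0
  · have hlt := hI.head_lt h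
    obtain ⟨h1, h2⟩ := hI.step hw h0 h (List.getElem?_eq_getElem hlt)
      (c := ⟨T.pos, hI.pos_lt⟩) rfl
    exact ⟨_, (runs_stepProg hE hR hW hq h (List.getElem?_eq_getElem hlt) rfl).mono cost_stepProg
      fun _ h => h, h1, fun _ => by rw [h2, hj (by omega)]⟩
  · exact ⟨T, (runs_stepProg_of_ne hR h).mono cost_stepProg fun _ h => h, hI,
      fun h2 => by have := hI.status_le; omega⟩

/-- A round takes at most `400` steps, `150` for each trial and the rest for the stopping test. The
race ends with a trial that has been completed without conflict, or with two conflicts. -/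
theorem exec_raceProg (hw : ∀ a b, w a b = w b a) (h0 : ∀ a, w a a = 0)
    (hW : n * n + n + m + 2 ≤ W) (hm : ∀ x T, Trial.Sound w S x T → T.queue.length ≤ m)
    {x : Bool → Fin n × Fin n} {T : Bool → Trial n} (hσ : Race m stamp w S x T 0 σ)
    (hst : ∀ s, (T s).status = 0) (h6 : σ.reg 6 = 1) :
    ∃ t σ', Exec W raceProg σ t σ' ∧ ∃ T' j, Race m stamp w S x T' j σ' ∧ Stopped T' ∧
      t ≤ 400 * j + 1 := by
  let I (t : ℕ) (σ : Store) : Prop :=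
    ∃ T j, Race m stamp w S x T j σ ∧ (σ.reg 6 = 1 ↔ ¬ Stopped T) ∧ t ≤ 400 * j
  have hstep : ∀ t σ, I t σ → Test.Holds σ (.eq (.reg 6) (.const 1)) → ∃ u σ',
      Exec W (block [stepProg false, stepProg true, stopProg]) σ u σ' ∧ I (t + u + 1) σ' := by
    rintro t σ ⟨T, j, h1, h2, h3⟩ hc
    have hns : ¬ Stopped T := h2.1 hc
    have hne : ∀ s, (T s).status ≠ 1 := by
      intro s h
      cases s
      · exact hns (Or.inl h)
      · exact hns (Or.inr (Or.inl h))
    have hlen : ∀ s, (T s).queue.length + 2 ≤ W := fun s => by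
      have := hm _ _ (h1.inv s).toSound
      omega
    have hj : j + 1 ≤ n * m := by
      obtain ⟨s, hs⟩ : ∃ s, (T s).status = 0 := by
        by_contra h
        push Not at h
        have e : ∀ s, (T s).status = 2 := fun s => by
          have := h s
          have := hne s
          have := (h1.inv s).status_le
          omega
        exact hns (Or.inr (Or.inr ⟨e _, e _⟩))
      have e1 := h1.round s (by omega)
      have e2 := (h1.inv s).head_lt hs
      have e3 := (h1.inv s).pos_lt
      have e4 := hm _ _ (h1.inv s).toSound
      have e5 : n * ((T s).head + 1) ≤ n * m := Nat.mul_le_mul_left _ (by omega)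
      rw [mul_add, mul_one] at e5
      omega
    obtain ⟨Tf, rf, If, jf⟩ := runs_stepProg_round hw h0 h1.env (h1.rep false) (h1.inv false)
      (by omega) (hlen false) (h1.round false) (hne false)
    have main : Runs W (block [stepProg false, stepProg true, stopProg]) σ 399 fun σ' =>
        ∃ T, Race m stamp w S x T (j + 1) σ' ∧ (σ'.reg 6 = 1 ↔ ¬ Stopped T) := by
      refine (rf.frame.seq (U := 249) fun σ₁ ⟨hR₁, hf₁⟩ => ?_).mono (by omega) fun _ h => h
      have hE₁ := h1.env.frame hf₁ (by decide) (by decide)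
      have hRt₁ := (h1.rep true).frame hf₁ (by decide) (by decide)
      obtain ⟨Tt, rt, It, jt⟩ := runs_stepProg_round hw h0 hE₁ hRt₁ (h1.inv true)
        (by omega) (hlen true) (h1.round true) (hne true)
      refine (rt.frame.seq (U := 99) fun σ₂ ⟨hRt₂, hf₂⟩ => ?_).mono (by omega) fun _ h => h
      have hE₂ := hE₁.frame hf₂ (by decide) (by decide)
      have hRf₂ := hR₁.frame hf₂ (by decide) (by decide)
      have h6 : σ₂.reg 6 = 1 := by
        rw [hf₂.1 6 (by decide), hf₁.1 6 (by decide)]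
        exact hc
      refine ((runs_of_fits (block [stopProg]) σ₂ ?_).frame).mono (by decide) ?_
      · simp [stopProg]
      · rintro σ₃ ⟨rfl, hf₃⟩
        refine ⟨fun s => if s then Tt else Tf, ⟨hE₂.frame hf₃ (by decide) (by decide), ?_, ?_, ?_,
          hj⟩, ?_⟩
        · rintro (_ | _)
          · exact hRf₂.frame hf₃ (by decide) (by decide)
          · exact hRt₂.frame hf₃ (by decide) (by decide)
        · rintro (_ | _)
          · exact If
          · exact It
        · rintro (_ | _)
          · exact jf
          · exact jt
        · have e1 := hRf₂.status
          have e2 := hRt₂.status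
          simp [treg] at e1 e2
          simp [stopProg, Stopped, treg, e1, e2, h6]
          split_ifs <;> simp_all
    obtain ⟨u, σ', e1, e2, T', e3, e4⟩ := main
    exact ⟨u, σ', e1, T', j + 1, e3, e4, by omega⟩
  obtain ⟨t, σ', h1, ⟨T', j, h2, h3, h4⟩, h5⟩ := exec_while (W := W) (s := σ) I
    ⟨T, 0, hσ, by simp [h6, Stopped, hst], le_rfl⟩
    (fun t σ ⟨T, j, h1, _, h3⟩ => h3.trans (Nat.mul_le_mul_left 400 h1.le)) hstep
  have h6 : ¬ σ'.reg 6 = 1 := h5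
  rw [h3, not_not] at h6
  exact ⟨t + 1, σ', h1, T', j, h2, h6, by omega⟩

end

/-! ### Making the decisions of a trial permanent -/

section

variable {n m stamp W : ℕ} {w : Fin n → Fin n → ℕ} {S : Set (Fin n × Fin n)} {s : Bool}
  {T : Trial n} {σ σ' : Store}

/-- Marking one more arc as permanently decided. -/
theorem Idle.insert (h : Idle m stamp S s σ) {x y : Fin n} {S' : Set (Fin n × Fin n)}
    (hS : ∀ p, p ∈ S' ↔ p ∈ S ∨ p = (x, y))
    (ha : σ'.arr (tarr s 0) = Function.update (σ.arr (tarr s 0)) (x * n + y) (m + 1)) :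
    Idle m stamp S' s σ' := by
  have hu : ∀ x' y' : Fin n, (x', y') ≠ (x, y) →
      σ'.arr (tarr s 0) (x' * n + y') = σ.arr (tarr s 0) (x' * n + y') := by
    intro x' y' h2
    rw [ha, Function.update_of_ne]
    intro h3
    obtain ⟨rfl, rfl⟩ := pair_index_inj h3
    exact h2 rfl
  refine ⟨fun x' y' h1 => ?_, fun x' y' h1 => ?_⟩
  · by_cases h2 : (x', y') = (x, y)
    · cases h2
      rw [ha, Function.update_self]
    · rw [hu x' y' h2]
      exact h.big x' y' (((hS _).1 h1).resolve_right h2)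
  · rw [hS, not_or] at h1
    rw [hu x' y' h1.2]
    exact h.lt x' y' h1.1

/-- Making the decisions of a trial permanent. -/
theorem exec_commitProg (hn : σ.reg 0 = n) (hb : σ.reg 40 = m + 1)
    (hI : ∀ r, Idle m stamp S r σ) {Q : List (Fin n × Fin n)} (hl : σ.reg (treg s 2) = Q.length)
    (ht : ∀ i p, Q[i]? = some p → σ.arr (tarr s 1) i = p.1)
    (hh : ∀ i p, Q[i]? = some p → σ.arr (tarr s 2) i = p.2)
    (hW : n * n + 2 ≤ W) (hq : Q.length + 1 ≤ W) :
    ∃ t σ', Exec W (commitProg s) σ t σ' ∧ t ≤ 20 * Q.length + 2 ∧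
      ∀ r, Idle m stamp {p | p ∈ S ∨ p ∈ Q} r σ' := by
  let I (t : ℕ) (τ : Store) : Prop := ∃ i ≤ Q.length, τ.reg 41 = i ∧ τ.reg 0 = n ∧
    τ.reg 40 = m + 1 ∧ τ.reg (treg s 2) = Q.length ∧ τ.arr (tarr s 1) = σ.arr (tarr s 1) ∧
    τ.arr (tarr s 2) = σ.arr (tarr s 2) ∧
    (∀ r, Idle m stamp {p | p ∈ S ∨ p ∈ Q.take i} r τ) ∧ t ≤ 20 * i
  have h0 : I 0 (σ.setReg 41 0) := by
    refine ⟨0, Nat.zero_le _, by simp, by simpa using hn, by simpa using hb, ?_, rfl, rfl, ?_,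
      le_rfl⟩
    · cases s <;> simpa [treg] using hl
    · intro r
      simpa using ⟨(hI r).big, (hI r).lt⟩
  obtain ⟨t, σ', h1, ⟨i, h2, h3, -, -, h4, -, -, h5, h6⟩, h7⟩ := exec_while (W := W)
    (c := .lt (.reg 41) (.reg (treg s 2)))
    (p := block [.load 10 (tarr s 1) (.reg 41), .load 11 (tarr s 2) (.reg 41), pairIndex 8 10 11,
        .store (tarr false 0) (.reg 8) (.reg 40), .store (tarr true 0) (.reg 8) (.reg 40),
        .op .add 41 (.reg 41) (.const 1)]) I h0 (B := 20 * Q.length)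
    (fun t τ ⟨i, h1, h⟩ => h.2.2.2.2.2.2.2.trans (Nat.mul_le_mul_left _ h1)) (by
      rintro t τ ⟨i, -, e1, e2, e3, e4, e5, e6, e7, e8⟩ hc
      have hi : i < Q.length := by simpa [e1, e4] using hc
      obtain ⟨⟨x, y⟩, hxy⟩ : ∃ p, Q[i]? = some p := ⟨_, List.getElem?_eq_getElem hi⟩
      have ht' := ht i _ hxy
      have hh' := hh i _ hxy
      have b1 := pair_index_lt x y
      obtain ⟨u, τ', f1, f2, f3⟩ := runs_of_fits (W := W)
        (block [.load 10 (tarr s 1) (.reg 41), .load 11 (tarr s 2) (.reg 41), pairIndex 8 10 11,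
        .store (tarr false 0) (.reg 8) (.reg 40), .store (tarr true 0) (.reg 8) (.reg 40),
        .op .add 41 (.reg 41) (.const 1)]) τ (by
          cases s <;> simp [tarr] at ht' hh' e5 e6 <;>
          simp [tarr, e1, e2, e5, e6, ht', hh'] <;> omega)
      have f4 := exec_frame f1
      have f2' : u ≤ 19 := f2.trans (by simp [cost])
      refine ⟨u, τ', f1, i + 1, hi, ?_, ?_, ?_, ?_, ?_, ?_, ?_, by omega⟩
      · simp [f3, e1]
      · rw [f4.1 0 (by simp [regsOf]), e2]
      · rw [f4.1 40 (by simp [regsOf]), e3]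
      · rw [f4.1 (treg s 2) (by cases s <;> simp [regsOf, treg]), e4]
      · rw [f4.2 (tarr s 1) (by cases s <;> simp [arrsOf, tarr]), e5]
      · rw [f4.2 (tarr s 2) (by cases s <;> simp [arrsOf, tarr]), e6]
      · intro r
        refine (e7 r).insert (x := x) (y := y) (fun p => ?_) ?_
        · rw [List.take_add_one, hxy]
          simp [or_assoc]
        · cases s <;> simp [tarr] at ht' hh' e5 e6 <;> cases r <;>
          simp [f3, tarr, e1, e2, e3, e5, e6, ht', hh'])
  have h8 : i = Q.length := by
    simp only [Test.Holds, Operand.val, h3, h4] at h7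
    omega
  subst h8
  rw [List.take_length] at h5
  refine ⟨1 + (t + 1), σ', .seq (.op σ .add 41 (.const 0) (.const 0) (by simp)) h1, by omega, h5⟩

end

/-! ### Deciding an edge -/

section

variable {n m stamp W : ℕ} {w : Fin n → Fin n → ℕ} {S : Set (Fin n × Fin n)} {s : Bool}
  {T : Trial n} {σ σ' : Store}

theorem runs_tryProg (hE : Env m stamp w σ) (hI : Idle m stamp S s σ) (hstamp : stamp ≤ m + 1)
    (hW : n * n + n + 2 ≤ W) {x y : Fin n} {rx ry : ℕ} (hx : σ.reg rx = x) (hy : σ.reg ry = y)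
    (hry : ry ≠ 10) (hxy : (x, y) ∉ S) :
    Runs W (tryProg s rx ry) σ 30 fun σ' => Rep m stamp S s (Trial.start (x, y)) σ' := by
  have l1 := x.isLt
  have l2 := y.isLt
  refine ((Runs.frame (runs_of_fits (.seq (assign 10 (.reg rx)) (assign 11 (.reg ry))) σ ?_)).seq
    (U := cost (startProg s)) ?_).mono (by cases s <;> simp [cost, startProg]) fun σ' h => h
  · simp [hx, hy, hry]; omega
  · rintro σ' ⟨rfl, hf⟩
    refine runs_startProg (hE.frame hf (by simp [regsOf]) (by simp [arrsOf]))
      (hI.frame hf (by simp [arrsOf])) hstamp (by omega) ?_ ?_ hxy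
    · simp [hx]
    · simp [hy, hry]

/-- The possible outcomes of deciding an edge `uv` within time `t`: the set of decisions has been
extended to a larger closed set, in time proportional to `n` for each new arc, or the previous
decisions do not extend to a solution. -/
inductive Outcome (m stamp : ℕ) (w : Fin n → Fin n → ℕ) (S : Set (Fin n × Fin n)) (u v : Fin n)
    (σ σ' : Store) (t : ℕ) : Prop
  | extended (S' : Set (Fin n × Fin n)) (sub : S ⊆ S')
      (closed : IsClosed w fun a b => (a, b) ∈ S') (mem : (u, v) ∈ S' ∨ (v, u) ∈ S')
      (idle : ∀ s, Idle m (stamp + 1) S' s σ') (edge : σ'.reg 2 = σ.reg 2)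
      (ok : σ'.reg 7 = σ.reg 7) (time : t + 600 * n * S.ncard ≤ 600 * n * S'.ncard)
  | failed (noSol : ∀ O : Set (Fin n × Fin n), IsSolution w (fun a b => (a, b) ∈ O) → ¬ S ⊆ O)
      (edge : σ'.reg 2 = m) (ok : σ'.reg 7 = 0) (time : t ≤ 400 * (n * m) + 100)

theorem Trial.Sound.length_le {x : Fin n × Fin n}
    (hcard : ∀ R : Set (Fin n × Fin n), (∀ p ∈ R, 0 < w p.1 p.2 ∧ p.swap ∉ R) → R.ncard ≤ m)
    (h : Trial.Sound w S x T) : T.queue.length ≤ m := by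
  classical
  have h1 : ((T.queue.toFinset : Finset _) : Set (Fin n × Fin n)).ncard ≤ m := by
    refine hcard _ fun p hp => ?_
    replace hp : p ∈ T.queue := by simpa using hp
    exact ⟨h.pos p hp, fun h' => h.asymm p hp (Or.inr (by simpa using h'))⟩
  rwa [Set.ncard_coe_finset, List.toFinset_card_of_nodup h.nodup] at h1

theorem Trial.Sound.ncard_arcs {x : Fin n × Fin n} (h : Trial.Sound w S x T) :
    (T.arcs S).ncard = S.ncard + T.queue.length := by
  classical
  have h1 : T.arcs S = S ∪ (T.queue.toFinset : Finset _) := by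
    ext p; simp [Trial.arcs]
  rw [h1, Set.ncard_union_eq ?_ (Set.toFinite _) (Set.toFinite _), Set.ncard_coe_finset,
    List.toFinset_card_of_nodup h.nodup]
  rw [Set.disjoint_left]
  intro p hp hq
  exact h.notMem p (by simpa using hq) hp

/-- After `j` rounds the winner of the race has derived `j / n` arcs, which pay `600 * n` steps
each: `400` for every round, and the rest for the start and for the `20` steps per arc of the
commitment. -/
theorem exec_commit_race (hW : n * n + n + m + 2 ≤ W)
    (hcard : ∀ R : Set (Fin n × Fin n), (∀ p ∈ R, 0 < w p.1 p.2 ∧ p.swap ∉ R) → R.ncard ≤ m)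
    (hS : IsClosed w fun a b => (a, b) ∈ S) {x : Bool → Fin n × Fin n} {T : Bool → Trial n} {j : ℕ}
    (hR : Race m stamp w S x T j σ) (s : Bool) (hst : (T s).status = 1) :
    ∃ t σ', Exec W (commitProg s) σ t σ' ∧ t + 400 * j + 100 + 600 * n * S.ncard ≤ 
      600 * n * ((T s).arcs S).ncard ∧
      (∀ r, Idle m (stamp + 1) ((T s).arcs S) r σ') ∧
      (IsClosed w fun a b => (a, b) ∈ (T s).arcs S) ∧ x s ∈ (T s).arcs S := by
  have hs := (hR.inv s).toSound
  have hlen := hs.length_le hcard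
  obtain ⟨t, σ', h1, h2, h3⟩ := exec_commitProg (W := W) (stamp := stamp + 1) hR.env.reg_n
    hR.env.reg_big (S := S) (m := m)
    (fun r => ⟨(hR.rep r).big, fun a b h => Nat.lt_succ_of_le ((hR.rep r).stamp_le a b h)⟩)
    (hR.rep s).length (hR.rep s).tails (hR.rep s).heads (by omega) (by omega)
  refine ⟨t, σ', h1, ?_, h3, (hR.inv s).isClosed hS hst, Or.inr hs.start_mem⟩
  have e1 := hR.round s (by omega)
  obtain ⟨e2, e3⟩ := (hR.inv s).finished hst
  have e4 : 0 < (T s).queue.length := List.length_pos_of_mem hs.start_mem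
  have e5 : 0 < n := (x s).1.pos
  rw [e2, e3, add_zero] at e1
  rw [hs.ncard_arcs, mul_add, mul_assoc 600 n (T s).queue.length, e1]
  have e6 : (T s).queue.length ≤ j := by
    rw [← e1]; exact Nat.le_mul_of_pos_left _ e5
  omega

theorem exec_decideProg (hw : ∀ a b, w a b = w b a) (h0 : ∀ a, w a a = 0)
    (hW : n * n + n + m + 2 ≤ W)
    (hcard : ∀ R : Set (Fin n × Fin n), (∀ p ∈ R, 0 < w p.1 p.2 ∧ p.swap ∉ R) → R.ncard ≤ m)
    (hE : Env m stamp w σ) (hI : ∀ s, Idle m stamp S s σ) (hstamp : stamp ≤ m + 1)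
    (hS : IsClosed w fun a b => (a, b) ∈ S) {u v : Fin n} (hu : σ.reg 4 = u) (hv : σ.reg 5 = v)
    (huv : 0 < w u v) (h1 : (u, v) ∉ S) (h2 : (v, u) ∉ S) :
    ∃ t σ', Exec W decideProg σ t σ' ∧ Outcome m stamp w S u v σ σ' t := by
  have hne : u ≠ v := by
    rintro rfl
    rw [h0] at huv
    exact huv.false
  let x (s : Bool) : Fin n × Fin n := if s then (v, u) else (u, v)
  obtain ⟨t₁, σ₁, e₁, b₁, rf, f₁⟩ := (runs_tryProg (s := false) hE (hI false) hstamp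
    (W := W) (by omega) hu hv (by decide) h1).frame
  have hE₁ := hE.frame f₁ (by decide) (by decide)
  have hI₁ := (hI true).frame f₁ (by decide)
  obtain ⟨t₂, σ₂, e₂, b₂, rt, f₂⟩ := (runs_tryProg (s := true) hE₁ hI₁ hstamp
    (W := W) (by omega) ((f₁.1 5 (by decide)).trans hv) ((f₁.1 4 (by decide)).trans hu)
    (by decide) h2).frame
  obtain ⟨t₃, σ₃, e₃, b₃, rfl, f₃⟩ := (runs_of_fits (assign 6 (.const 1)) σ₂
    (W := W) (by simp; omega)).frame
  have hr : Race m stamp w S x (fun s => Trial.start (x s)) 0 (run (assign 6 (.const 1)) σ₂) := by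
    refine ⟨(hE₁.frame f₂ (by decide) (by decide)).frame f₃ (by decide) (by decide), ?_, ?_, ?_,
      Nat.zero_le _⟩
    · rintro (_ | _)
      · exact (Rep.frame rf f₂ (by decide) (by decide)).frame f₃ (by decide) (by decide)
      · exact Rep.frame rt f₃ (by decide) (by decide)
    · rintro (_ | _)
      · exact Trial.inv_start hS hne huv h1 h2
      · exact Trial.inv_start hS hne.symm (hw u v ▸ huv) h2 h1
    · intro s _
      simp [Trial.start]
  obtain ⟨t₄, σ₄, e₄, T, j, hR, hT, b₄⟩ := exec_raceProg hw h0 hW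
    (fun _ _ h => Trial.Sound.length_le hcard h) hr (by intro s; rfl) (by simp)
  have b₃' : t₃ ≤ 1 := b₃
  have f₄ := exec_frame e₄
  have key : ∀ {t₅ σ₅}, Exec W (.ite (.eq (.reg (treg false 0)) (.const 1)) 
      (commitProg false) (.ite (.eq (.reg (treg true 0)) (.const 1)) (commitProg true)
        (.seq (assign 7 (.const 0)) (assign 2 (.reg 1))))) σ₄ t₅ σ₅ → 
      Exec W decideProg σ (t₁ + (t₂ + (t₃ + (t₄ + (t₅ + 1))))) σ₅ := fun h =>
    .seq e₁ (.seq e₂ (.seq e₃ (.seq e₄ (.seq h (.skip _)))))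
  have hedge : σ₄.reg 2 = σ.reg 2 ∧ σ₄.reg 7 = σ.reg 7 := by
    constructor <;>
    rw [f₄.1 _ (by decide), f₃.1 _ (by decide), f₂.1 _ (by decide), f₁.1 _ (by decide)]
  have hst (s : Bool) : Test.Holds σ₄ (.eq (.reg (treg s 0)) (.const 1)) ↔ (T s).status = 1 := by
    rw [← (hR.rep s).status]; rfl
  have won (s : Bool) {t₅ t₆ : ℕ} {σ₅ : Store}
      (ht : t₅ + 400 * j + 100 + 600 * n * S.ncard ≤ 600 * n * ((T s).arcs S).ncard)
      (h5 : ∀ r, Idle m (stamp + 1) ((T s).arcs S) r σ₅)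
      (hc : IsClosed w fun a b => (a, b) ∈ (T s).arcs S) (hx : x s ∈ (T s).arcs S)
      (h6 : t₆ ≤ t₅ + 2) (hf : σ₅.reg 2 = σ₄.reg 2 ∧ σ₅.reg 7 = σ₄.reg 7) :
      Outcome m stamp w S u v σ σ₅ (t₁ + (t₂ + (t₃ + (t₄ + (t₆ + 1))))) := by
    refine .extended ((T s).arcs S) (fun p hp => Or.inl hp) hc ?_ h5 (hf.1.trans hedge.1)
      (hf.2.trans hedge.2) (by omega)
    cases s
    · exact Or.inl hx
    · exact Or.inr hx
  by_cases c1 : (T false).status = 1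
  · obtain ⟨t₅, σ₅, e₅, b₅, i₅, hc, hx⟩ := exec_commit_race hW hcard hS hR false c1
    have f₅ := exec_frame e₅
    exact ⟨_, _, key (.ite_true ((hst false).2 c1) e₅),
      won false b₅ i₅ hc hx (by omega) ⟨f₅.1 2 (by decide), f₅.1 7 (by decide)⟩⟩
  · by_cases c2 : (T true).status = 1
    · obtain ⟨t₅, σ₅, e₅, b₅, i₅, hc, hx⟩ := exec_commit_race hW hcard hS hR true c2
      have f₅ := exec_frame e₅
      exact ⟨_, _, key (.ite_false (mt (hst false).1 c1) (.ite_true ((hst true).2 c2) e₅)),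
        won true b₅ i₅ hc hx le_rfl ⟨f₅.1 2 (by decide), f₅.1 7 (by decide)⟩⟩
    · have c3 : (T false).status = 2 ∧ (T true).status = 2 := by
        rcases hT with h | h | h
        · exact absurd h c1
        · exact absurd h c2
        · exact h
      have hjle := hR.le
      refine ⟨_, _, key (.ite_false (mt (hst false).1 c1) (.ite_false (mt (hst true).1 c2)
        (.seq (.op _ _ _ _ _ (by simp)) (.op _ _ _ _ _ ?_)))), .failed ?_ ?_ ?_ ?_⟩
      · simp [hR.env.reg_m]; omega
      · intro O hO hSO
        rcases hO.total huv with h | h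
        · exact ((hR.inv false).forced O hO hSO h).2 c3.1
        · exact ((hR.inv true).forced O hO hSO h).2 c3.2
      · simp [hR.env.reg_m]
      · simp
      · omega

end

/-! ### Treating one edge of the list -/

/-- The arc `p` has been written as the orientation of the edge number `i` of the list `L`. -/
def IsOutput {n : ℕ} (L : List (Fin n × Fin n)) (i : ℕ) (p : Fin n × Fin n) (σ : Store) : Prop :=
  σ.arr 3 i = p.1 ∧ σ.arr 4 i = p.2 ∧ (L[i]? = some p ∨ L[i]? = some p.swap)

/-- The first `e` edges of `L` have been decided; `S` is the set of decisions. -/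
structure Progress {n : ℕ} (m : ℕ) (w : Fin n → Fin n → ℕ) (L : List (Fin n × Fin n))
    (S : Set (Fin n × Fin n)) (e : ℕ) (σ : Store) : Prop where
  reg_n : σ.reg 0 = n
  reg_m : σ.reg 1 = m
  reg_edge : σ.reg 2 = e
  reg_ok : σ.reg 7 = 1
  reg_big : σ.reg 40 = m + 1
  weight : ∀ x y : Fin n, σ.arr 5 (x * n + y) = w x y
  tails : ∀ i p, L[i]? = some p → σ.arr 0 i = p.1
  heads : ∀ i p, L[i]? = some p → σ.arr 1 i = p.2
  le : e ≤ m
  closed : IsClosed w fun a b => (a, b) ∈ S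
  idle : ∀ s, Idle m (e + 1) S s σ
  out : ∀ i < e, ∃ p ∈ S, IsOutput L i p σ

section

variable {n m e W : ℕ} {w : Fin n → Fin n → ℕ} {L : List (Fin n × Fin n)}
  {S : Set (Fin n × Fin n)} {σ σ' : Store}

theorem Idle.mono {stamp stamp' : ℕ} {s : Bool} (h : Idle m stamp S s σ) (hs : stamp ≤ stamp') :
    Idle m stamp' S s σ :=
  ⟨h.big, fun x y hxy => (h.lt x y hxy).trans_le hs⟩

theorem runs_outputProg {u v : Fin n} (hn : σ.reg 0 = n) (he : σ.reg 2 = e) (hu : σ.reg 4 = u)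
    (hv : σ.reg 5 = v) (hb : σ.reg 40 = m + 1) (hI : Idle m (e + 2) S false σ)
    (he' : e < m) (hW : n * n + m + 2 ≤ W) (hL : L[e]? = some (u, v))
    (hmem : (u, v) ∈ S ∨ (v, u) ∈ S)
    (hout : ∀ i < e, ∃ p ∈ S, IsOutput L i p σ) :
    Runs W (.seq outputProg (.op .add 2 (.reg 2) (.const 1))) σ 20 fun σ' =>
      σ'.reg 2 = e + 1 ∧ ∀ i < e + 1, ∃ p ∈ S, IsOutput L i p σ' := by
  have b1 := pair_index_lt u v
  refine (runs_of_fits _ _ ?_).mono (by decide) ?_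
  · simp [outputProg, hn, hu, hv, he]; omega
  · rintro σ' rfl
    refine ⟨by simp [outputProg, he], fun i hi => ?_⟩
    by_cases huv : (u, v) ∈ S
    · have h1 := hI.big u v huv
      simp [tarr] at h1
      rcases Nat.lt_succ_iff_lt_or_eq.1 hi with h2 | rfl
      · obtain ⟨p, hp, h3, h4, h5⟩ := hout i h2
        refine ⟨p, hp, ?_, ?_, h5⟩ <;>
        simp [outputProg, hn, hu, hv, he, tarr, h1, hb, h2.ne, h3, h4]
      · refine ⟨_, huv, ?_, ?_, Or.inl hL⟩ <;>
        simp [outputProg, hn, hu, hv, he, tarr, h1, hb]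
    · have h1 := hI.lt u v huv
      simp [tarr] at h1
      have h0 : σ.arr 6 (u * n + v) ≠ m + 1 := by omega
      rcases Nat.lt_succ_iff_lt_or_eq.1 hi with h2 | rfl
      · obtain ⟨p, hp, h3, h4, h5⟩ := hout i h2
        refine ⟨p, hp, ?_, ?_, h5⟩ <;>
        simp [outputProg, hn, hu, hv, he, tarr, h0, hb, h2.ne, h3, h4]
      · refine ⟨_, hmem.resolve_left huv, ?_, ?_, Or.inr hL⟩ <;>
        simp [outputProg, hn, hu, hv, he, tarr, h0, hb]

theorem runs_fetchProg {u v : Fin n} (hP : Progress m w L S e σ) (hW : n * n + m + 2 ≤ W)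
    (hL : L[e]? = some (u, v)) :
    Runs W fetchProg σ 20 fun σ' => σ'.reg 3 = e + 1 ∧ σ'.reg 4 = u ∧ σ'.reg 5 = v ∧
      (σ'.reg 9 < e + 1 ↔ (u, v) ∉ S) ∧ (σ'.reg 17 < e + 1 ↔ (v, u) ∉ S) := by
  have b1 := pair_index_lt u v
  have b2 := pair_index_lt v u
  have h1 := hP.tails e _ hL
  have h2 := hP.heads e _ hL
  have h3 := hP.le
  have hn := hP.reg_n
  have he := hP.reg_edge
  have key (x y : Fin n) : σ.arr 6 (x * n + y) < e + 1 ↔ (x, y) ∉ S := by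
    refine ⟨fun h h' => ?_, (hP.idle false).lt x y⟩
    have : σ.arr 6 (x * n + y) = m + 1 := (hP.idle false).big x y h'
    omega
  refine (runs_of_fits _ _ ?_).mono (by decide) ?_
  · simp [fetchProg, hn, he, tarr, h1, h2]; omega
  · rintro σ' rfl
    refine ⟨?_, ?_, ?_, ?_, ?_⟩ <;> simp [fetchProg, hn, he, tarr, h1, h2, key]

/-- Either one more edge has been decided, or no solution extends the decisions. -/
theorem exec_edgeProg (hw : ∀ a b, w a b = w b a) (h0 : ∀ a, w a a = 0)
    (hW : n * n + n + m + 2 ≤ W)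
    (hcard : ∀ R : Set (Fin n × Fin n), (∀ p ∈ R, 0 < w p.1 p.2 ∧ p.swap ∉ R) → R.ncard ≤ m)
    (hP : Progress m w L S e σ) (he : e < m) {u v : Fin n} (hL : L[e]? = some (u, v))
    (huv : 0 < w u v) :
    ∃ t σ', Exec W edgeProg σ t σ' ∧
      ((∃ S', Progress m w L S' (e + 1) σ' ∧ t + 600 * n * S.ncard ≤ 600 * n * S'.ncard + 50) ∨
        ((∀ O : Set (Fin n × Fin n), IsSolution w (fun a b => (a, b) ∈ O) → ¬ S ⊆ O) ∧
          σ'.reg 2 = m + 1 ∧ σ'.reg 7 = 0 ∧ t ≤ 400 * (n * m) + 150)) := by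
  obtain ⟨t₁, σ₁, e₁, b₁, ⟨h3, h4, h5, h9, h17⟩, f₁⟩ :=
    (runs_fetchProg (W := W) hP (by omega) hL).frame
  have hE : Env m (e + 1) w σ₁ :=
    ⟨(f₁.1 0 (by decide)).trans hP.reg_n, (f₁.1 1 (by decide)).trans hP.reg_m, h3,
      (f₁.1 40 (by decide)).trans hP.reg_big, fun x y => by
        rw [f₁.2 5 (by decide)]; exact hP.weight x y⟩
  have hI (s : Bool) : Idle m (e + 1) S s σ₁ := (hP.idle s).frame f₁ (by cases s <;> decide)
  obtain ⟨t₂, σ₂, e₂, h2⟩ : ∃ t σ₂, Exec W (.ite (.lt (.reg 9) (.reg 3))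
      (.ite (.lt (.reg 17) (.reg 3)) decideProg .skip) .skip) σ₁ t σ₂ ∧
      ((∃ S', IsClosed w (fun a b => (a, b) ∈ S') ∧ S ⊆ S' ∧ ((u, v) ∈ S' ∨ (v, u) ∈ S') ∧
        (∀ s, Idle m (e + 2) S' s σ₂) ∧ σ₂.reg 2 = σ₁.reg 2 ∧ σ₂.reg 7 = σ₁.reg 7 ∧
        t + 600 * n * S.ncard ≤ 600 * n * S'.ncard + 3) ∨
        ((∀ O : Set (Fin n × Fin n), IsSolution w (fun a b => (a, b) ∈ O) → ¬ S ⊆ O) ∧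
          σ₂.reg 2 = m ∧ σ₂.reg 7 = 0 ∧ t ≤ 400 * (n * m) + 102)) := by
    have c1 : Test.Holds σ₁ (.lt (.reg 9) (.reg 3)) ↔ (u, v) ∉ S := by
      rw [← h9, ← h3]; rfl
    have c2 : Test.Holds σ₁ (.lt (.reg 17) (.reg 3)) ↔ (v, u) ∉ S := by
      rw [← h17, ← h3]; rfl
    by_cases d1 : (u, v) ∈ S
    · exact ⟨_, _, .ite_false (mt c1.1 (not_not_intro d1)) (.skip σ₁), Or.inl
        ⟨S, hP.closed, subset_rfl, Or.inl d1, fun s => (hI s).mono (by omega), rfl, rfl, by omega⟩⟩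
    by_cases d2 : (v, u) ∈ S
    · exact ⟨_, _, .ite_true (c1.2 d1) (.ite_false (mt c2.1 (not_not_intro d2)) (.skip σ₁)), Or.inl
        ⟨S, hP.closed, subset_rfl, Or.inr d2, fun s => (hI s).mono (by omega), rfl, rfl, by omega⟩⟩
    obtain ⟨t, σ₂, e₂, h⟩ :=
      exec_decideProg hw h0 hW hcard hE hI (by omega) hP.closed h4 h5 huv d1 d2
    refine ⟨_, _, .ite_true (c1.2 d1) (.ite_true (c2.2 d2) e₂), ?_⟩
    rcases h with ⟨S', i1, i2, i3, i4, i5, i6, i7⟩ | ⟨i1, i2, i3, i4⟩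
    · exact Or.inl ⟨S', i2, i1, i3, i4, i5, i6, by omega⟩
    · exact Or.inr ⟨i1, i2, i3, by omega⟩
  have f₂ := exec_frame e₂
  rcases h2 with ⟨S', i1, i2, i3, i4, i5, i6, i7⟩ | ⟨i1, i2, i3, i4⟩
  · have hE₂ := hE.frame f₂ (by decide) (by decide)
    obtain ⟨t₃, σ₃, e₃, b₃, ⟨h6, h7⟩, f₃⟩ := (runs_outputProg (W := W) (σ := σ₂) (m := m) (L := L)
      (e := e) hE₂.reg_n (by rw [i5, f₁.1 2 (by decide), hP.reg_edge])
      (by rw [f₂.1 4 (by decide), h4]) (by rw [f₂.1 5 (by decide), h5]) hE₂.reg_big (i4 false) he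
      (by omega) hL i3 (fun i hi => by
        obtain ⟨p, hp, k1, k2, k3⟩ := hP.out i hi
        refine ⟨p, i2 hp, ?_, ?_, k3⟩
        · rw [f₂.2 3 (by decide), f₁.2 3 (by decide), k1]
        · rw [f₂.2 4 (by decide), f₁.2 4 (by decide), k2])).frame
    have hE₃ := hE₂.frame f₃ (by decide) (by decide)
    refine ⟨_, σ₃, .seq e₁ (.seq e₂ (.seq e₃ (.skip _))), Or.inl ⟨S', ⟨hE₃.reg_n, hE₃.reg_m, h6, ?_,
      hE₃.reg_big, hE₃.weight, ?_, ?_, he, i1, fun s => (i4 s).frame f₃ (by cases s <;> decide),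
      h7⟩,
      by omega⟩⟩
    · rw [f₃.1 7 (by decide), i6, f₁.1 7 (by decide), hP.reg_ok]
    · rw [f₃.2 0 (by decide), f₂.2 0 (by decide), f₁.2 0 (by decide)]; exact hP.tails
    · rw [f₃.2 1 (by decide), f₂.2 1 (by decide), f₁.2 1 (by decide)]; exact hP.heads
  · have hE₂ := hE.frame f₂ (by decide) (by decide)
    have b1 := pair_index_lt u v
    have g4 : σ₂.reg 4 = u := by rw [f₂.1 4 (by decide), h4]
    have g5 : σ₂.reg 5 = v := by rw [f₂.1 5 (by decide), h5]
    obtain ⟨t₃, σ₃, e₃, b₃, rfl, f₃⟩ := (runs_of_fits (W := W)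
      (.seq outputProg (.op .add 2 (.reg 2) (.const 1))) σ₂ (by
        simp [outputProg, hE₂.reg_n, g4, g5, i2]; omega)).frame
    have b₃' : t₃ ≤ 20 := b₃.trans (by decide)
    refine ⟨_, _, .seq e₁ (.seq e₂ (.seq e₃ (.skip _))), Or.inr ⟨i1, ?_, ?_, by omega⟩⟩
    · simp [outputProg, i2]
    · rw [f₃.1 7 (by decide), i3]

end

/-! ### The main loop -/

section

variable {n m W : ℕ} {w : Fin n → Fin n → ℕ} {L : List (Fin n × Fin n)} {σ : Store}

theorem getElem?_mem_or {α : Type*} {L : List (α × α)} {p : α × α} (h : p ∈ L ∨ p.swap ∈ L) :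
    ∃ i < L.length, L[i]? = some p ∨ L[i]? = some p.swap := by
  rcases h with h | h <;> obtain ⟨i, hi, h1⟩ := List.getElem_of_mem h
  · exact ⟨i, hi, Or.inl (by rw [List.getElem?_eq_getElem hi, h1])⟩
  · exact ⟨i, hi, Or.inr (by rw [List.getElem?_eq_getElem hi, h1])⟩

/-- Writing the matrix of weights. -/
theorem exec_matrixProg (hw : ∀ a b, w a b = w b a) (hn : σ.reg 0 = n) (hm : σ.reg 1 = L.length)
    (h2 : σ.reg 2 = 0) (h5 : ∀ i, σ.arr 5 i = 0)
    (hL : ∀ i p, L[i]? = some p → σ.arr 0 i = p.1 ∧ σ.arr 1 i = p.2 ∧ σ.arr 2 i + 1 = w p.1 p.2)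
    (h0 : ∀ x y, (x, y) ∉ L → (y, x) ∉ L → w x y = 0)
    (hW : n * n + L.length + 2 ≤ W) (hwW : ∀ p ∈ L, w p.1 p.2 ≤ W) :
    ∃ t σ', Exec W matrixProg σ t σ' ∧ t ≤ 20 * L.length + 1 ∧
      ∀ x y : Fin n, σ'.arr 5 (x * n + y) = w x y := by
  classical
  let I (t : ℕ) (τ : Store) : Prop := ∃ i ≤ L.length, τ.reg 2 = i ∧ τ.reg 0 = n ∧
    τ.reg 1 = L.length ∧ (∀ A ∈ [0, 1, 2], τ.arr A = σ.arr A) ∧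
    (∀ x y : Fin n, τ.arr 5 (x * n + y) =
      if (x, y) ∈ L.take i ∨ (y, x) ∈ L.take i then w x y else 0) ∧ t ≤ 20 * i
  obtain ⟨t, σ', h1, ⟨i, hi, e2, -, e1, -, e5, ht⟩, hc⟩ := exec_while (W := W)
    (c := .lt (.reg 2) (.reg 1))
    (p := block [.load 4 0 (.reg 2), .load 5 1 (.reg 2), .load 9 2 (.reg 2),
      .op .add 9 (.reg 9) (.const 1), pairIndex 8 4 5, .store 5 (.reg 8) (.reg 9),
      pairIndex 8 5 4, .store 5 (.reg 8) (.reg 9), .op .add 2 (.reg 2) (.const 1)])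
    (B := 20 * L.length) (s := σ) I
    ⟨0, Nat.zero_le _, h2, hn, hm, fun _ _ => rfl, by simp [h5], le_rfl⟩
    (fun t τ ⟨i, h1, h⟩ => h.2.2.2.2.2.trans (Nat.mul_le_mul_left _ h1)) (by
      rintro t τ ⟨i, -, e2, e0, e1, eA, e5, ht⟩ hc
      have hi : i < L.length := by simpa [e1, e2] using hc
      obtain ⟨⟨u, v⟩, huv⟩ : ∃ p, L[i]? = some p := ⟨_, List.getElem?_eq_getElem hi⟩
      obtain ⟨hu, hv, hl⟩ := hL i _ huv
      have hlW := hwW _ (List.mem_of_getElem? huv)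
      rw [← eA 0 (by simp)] at hu
      rw [← eA 1 (by simp)] at hv
      rw [← eA 2 (by simp)] at hl
      simp only at hu hv hl hlW
      have b1 := pair_index_lt u v
      have b2 := pair_index_lt v u
      obtain ⟨c, τ', f1, f2, f3⟩ := runs_of_fits (W := W)
        (block [.load 4 0 (.reg 2), .load 5 1 (.reg 2), .load 9 2 (.reg 2),
      .op .add 9 (.reg 9) (.const 1), pairIndex 8 4 5, .store 5 (.reg 8) (.reg 9),
      pairIndex 8 5 4, .store 5 (.reg 8) (.reg 9), .op .add 2 (.reg 2) (.const 1)]) τ (by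
          simp [e2, e0, hu, hv, hl]; omega)
      have f4 := exec_frame f1
      have f2' : c ≤ 19 := f2.trans (by decide)
      have ha : τ'.arr 5 = Function.update (Function.update (τ.arr 5) (u * n + v) (w u v))
          (v * n + u) (w u v) := by
        simp [f3, e2, e0, hu, hv, hl]
      refine ⟨c, τ', f1, i + 1, hi, by simp [f3, e2], ?_, ?_, ?_, ?_, by omega⟩
      · rw [f4.1 0 (by decide), e0]
      · rw [f4.1 1 (by decide), e1]
      · intro A hA
        rw [f4.2 A (by simp at hA; rcases hA with rfl | rfl | rfl <;> decide), eA A hA]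
      · intro x y
        rw [List.take_add_one, huv, ha]
        by_cases c1 : (x, y) = (v, u)
        · cases c1
          rw [Function.update_self, if_pos (by simp), hw]
        by_cases c2 : (x, y) = (u, v)
        · cases c2
          have : ((u : ℕ) * n + v) ≠ v * n + u := fun h => by
            obtain ⟨rfl, -⟩ := pair_index_inj h
            exact c1 rfl
          rw [Function.update_of_ne this, Function.update_self, if_pos (by simp)]
        · rw [Function.update_of_ne, Function.update_of_ne, e5]
          · have c3 : (x, y) ∈ L.take i ++ (some (u, v)).toList ↔ (x, y) ∈ L.take i := by
              simpa using fun h1 h2 => absurd (by rw [h1, h2]) c2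
            have c4 : (y, x) ∈ L.take i ++ (some (u, v)).toList ↔ (y, x) ∈ L.take i := by
              simpa using fun h1 h2 => absurd (by rw [h1, h2]) c1
            simp only [c3, c4]
          · intro h
            obtain ⟨rfl, rfl⟩ := pair_index_inj h
            exact c2 rfl
          · intro h
            obtain ⟨rfl, rfl⟩ := pair_index_inj h
            exact c1 rfl)
  have h8 : i = L.length := by
    simp only [Test.Holds, Operand.val, e1, e2] at hc
    omega
  subst h8
  refine ⟨_, σ', h1, by omega, fun x y => ?_⟩
  rw [e5, List.take_length]
  split_ifs with h
  · rfl
  · exact (h0 x y (fun h' => h (Or.inl h')) fun h' => h (Or.inr h')).symm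

/-- The result of the main loop: a solution has been written to the output arrays, or there is
none. -/
theorem exec_mainLoop (hw : ∀ a b, w a b = w b a) (h0 : ∀ a, w a a = 0)
    (hcard : ∀ R : Set (Fin n × Fin n), (∀ p ∈ R, 0 < w p.1 p.2 ∧ p.swap ∉ R) →
      R.ncard ≤ L.length)
    (hpos : ∀ x y, 0 < w x y ↔ (x, y) ∈ L ∨ (y, x) ∈ L)
    (hW : n * n + n + L.length + 2 ≤ W) (hP : Progress L.length w L ∅ 0 σ) :
    ∃ t σ', Exec W (.while (.lt (.reg 2) (.reg 1)) edgeProg) σ t σ' ∧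
      t ≤ 1000 * (n * L.length) + 51 * L.length + 160 ∧
      ((σ'.reg 7 = 1 ∧ IsSolution w fun a b => (a, b) ∈ outputArcs n L.length σ') ∨
        (σ'.reg 7 = 0 ∧ ∀ O : Set (Fin n × Fin n), ¬ IsSolution w fun a b => (a, b) ∈ O)) := by
  let I (t : ℕ) (τ : Store) : Prop :=
    (∃ S e, Progress L.length w L S e τ ∧ t ≤ 600 * n * S.ncard + 51 * e) ∨
    ((∀ O : Set (Fin n × Fin n), ¬ IsSolution w fun a b => (a, b) ∈ O) ∧ τ.reg 1 = L.length ∧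
      τ.reg 2 = L.length + 1 ∧ τ.reg 7 = 0 ∧ t ≤ 1000 * (n * L.length) + 51 * L.length + 155)
  have hn {S : Set (Fin n × Fin n)} {e : ℕ} {τ : Store} (h : Progress L.length w L S e τ) :
      600 * n * S.ncard ≤ 600 * (n * L.length) := by
    rw [mul_assoc]
    exact Nat.mul_le_mul_left _ (Nat.mul_le_mul_left _
      (hcard S fun p hp => ⟨h.closed.pos hp, h.closed.asymm hp⟩))
  obtain ⟨t, σ', h1, h2, hc⟩ := exec_while (W := W) (c := .lt (.reg 2) (.reg 1)) (p := edgeProg)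
    (B := 1000 * (n * L.length) + 51 * L.length + 155) (s := σ) I
    (Or.inl ⟨∅, 0, hP, Nat.zero_le _⟩) (by
      rintro t τ (⟨S, e, h1, h2⟩ | h)
      · have := hn h1
        have := h1.le
        omega
      · exact h.2.2.2.2) (by
      rintro t τ (⟨S, e, h1, h2⟩ | h) hc
      · have he : e < L.length := by simpa [h1.reg_edge, h1.reg_m] using hc
        obtain ⟨u, τ', f1, f2⟩ := exec_edgeProg hw h0 hW hcard h1 he
          (u := L[e].1) (v := L[e].2) (List.getElem?_eq_getElem he)
          ((hpos _ _).2 (Or.inl (List.getElem_mem he)))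
        refine ⟨u, τ', f1, ?_⟩
        rcases f2 with ⟨S', g1, g2⟩ | ⟨g1, g2, g3, g4⟩
        · exact Or.inl ⟨S', e + 1, g1, by omega⟩
        · refine Or.inr ⟨fun O hO => ?_, ?_, g2, g3, ?_⟩
          · obtain ⟨O', i1, i2⟩ := hO.exists_extension hw h1.closed
            exact g1 {p | O' p.1 p.2} i1 fun p hp => i2 _ _ hp
          · rw [(exec_frame f1).1 1 (by decide), h1.reg_m]
          · have := hn h1
            omega
      · simp [h.2.1, h.2.2.1] at hc)
  refine ⟨_, σ', h1, ?_, ?_⟩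
  · rcases h2 with ⟨S, e, h2, h3⟩ | h2
    · have := hn h2
      have := h2.le
      omega
    · omega
  · rcases h2 with ⟨S, e, h2, -⟩ | h2
    · left
      have he : e = L.length := by
        have := h2.le
        simp only [Test.Holds, Operand.val, h2.reg_edge, h2.reg_m] at hc
        omega
      subst he
      have hout : ∀ p : Fin n × Fin n, p ∈ L ∨ p.swap ∈ L →
          ∃ q ∈ S, (q = p ∨ q = p.swap) ∧ q ∈ outputArcs n L.length σ' := by
        intro p hp
        obtain ⟨i, hi, h3⟩ := getElem?_mem_or hp
        obtain ⟨q, hq, h4, h5, h6⟩ := h2.out i hi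
        refine ⟨q, hq, ?_, i, hi, h4, h5⟩
        rcases h3 with h3 | h3 <;> rcases h6 with h6 | h6 <;> rw [h3, Option.some.injEq] at h6
        · exact Or.inl h6.symm
        · exact Or.inr (by rw [h6, Prod.swap_swap])
        · exact Or.inr h6.symm
        · exact Or.inl (Prod.swap_injective h6).symm
      have hS : outputArcs n L.length σ' = S := by
        ext p
        constructor
        · rintro ⟨i, hi, h3, h4⟩
          obtain ⟨q, hq, h5, h6, -⟩ := h2.out i hi
          have : p = q := Prod.ext (Fin.ext (h3.symm.trans h5)) (Fin.ext (h4.symm.trans h6))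
          rwa [this]
        · intro hp
          obtain ⟨q, h3, rfl | rfl, h4⟩ := hout p ((hpos _ _).1 (h2.closed.pos hp))
          · exact h4
          · exact absurd h3 (h2.closed.asymm hp)
      refine ⟨h2.reg_ok, ?_⟩
      rw [hS]
      refine ⟨h2.closed, fun {a b} hab => ?_⟩
      obtain ⟨q, h3, rfl | rfl, -⟩ := hout (a, b) ((hpos _ _).1 hab)
      · exact Or.inl h3
      · exact Or.inr h3
    · exact Or.inr ⟨h2.2.2.2.1, h2.1⟩

end

/-! ### Counting edges -/

section

variable {n : ℕ} {𝒢 : TemporalGraph (Fin n)} {L : List (Fin n × Fin n)}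

theorem ncard_le_numEdges (R : Set (Fin n × Fin n))
    (hR : ∀ p ∈ R, 0 < weight 𝒢 p.1 p.2 ∧ p.swap ∉ R) : R.ncard ≤ 𝒢.numEdges := by
  refine Set.ncard_le_ncard_of_injOn (fun p => s(p.1, p.2))
    (fun p hp => (weight_pos_iff 𝒢).1 (hR p hp).1) ?_ (Set.toFinite _)
  intro p hp q hq h
  rcases Sym2.eq_iff.1 h with ⟨h1, h2⟩ | ⟨h1, h2⟩
  · exact Prod.ext h1 h2
  · refine absurd hq ?_
    have : q = p.swap := Prod.ext h2.symm h1.symm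
    rw [this]
    exact (hR p hp).2

theorem length_eq_numEdges (hL : 𝒢.IsEdgeList L) : L.length = 𝒢.numEdges := by
  classical
  have h : 𝒢.graph.edgeSet = ((L.map fun p => s(p.1, p.2)).toFinset : Set (Sym2 (Fin n))) := by
    ext e
    rw [← hL.2 e]
    simp
  rw [numEdges, h, Set.ncard_coe_finset, List.toFinset_card_of_nodup hL.1, List.length_map]

theorem length_le_sq (hL : 𝒢.IsEdgeList L) : L.length ≤ n * n := by
  simpa using (List.Nodup.of_map _ hL.1).length_le_card

theorem weight_pos_iff_mem (hL : 𝒢.IsEdgeList L) (x y : Fin n) :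
    0 < weight 𝒢 x y ↔ (x, y) ∈ L ∨ (y, x) ∈ L := by
  rw [weight_pos_iff, ← SimpleGraph.mem_edgeSet, ← hL.2, List.mem_map]
  constructor
  · rintro ⟨p, hp, h⟩
    rcases Sym2.eq_iff.1 h with ⟨rfl, rfl⟩ | ⟨rfl, rfl⟩
    · exact Or.inl hp
    · exact Or.inr hp
  · rintro (h | h)
    · exact ⟨_, h, rfl⟩
    · exact ⟨_, h, Sym2.eq_swap⟩

end

/-! ### Correctness and running time -/

/-- The algorithm solves the orientation problem in time `O(nm)`. -/
theorem exec_orientProg {n W Λ : ℕ} {𝒢 : TemporalGraph (Fin n)} {L : List (Fin n × Fin n)}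
    (hL : 𝒢.IsEdgeList L) (hΛ : ∀ e ∈ 𝒢.graph.edgeSet, 𝒢.label e ≤ Λ)
    (hW : n * n + n + L.length + 2 ≤ W) (hΛW : Λ + 1 ≤ W) :
    ∃ t σ', Exec W orientProg (𝒢.inputStore L) t σ' ∧
      t ≤ 1000 * (n * L.length) + 71 * L.length + 170 ∧ 𝒢.IsSolvedBy σ' := by
  have hlen := length_eq_numEdges hL
  have hpos := weight_pos_iff_mem hL
  let σ₀ := 𝒢.inputStore L
  obtain ⟨t₁, σ₁, e₁, b₁, hσ₁, f₁⟩ := (runs_of_fits (W := W)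
    (.seq (.op .add 40 (.reg 1) (.const 1)) (.seq (assign 7 (.const 1)) (assign 2 (.const 0))))
      σ₀ (by
      simp [σ₀, inputStore]; omega)).frame
  obtain ⟨t₂, σ₂, e₂, b₂, h₂⟩ := exec_matrixProg (W := W) (w := weight 𝒢) (L := L) (σ := σ₁)
    (weight_comm 𝒢) (by simp [hσ₁, σ₀, inputStore]) (by simp [hσ₁, σ₀, inputStore])
    (by simp [hσ₁]) (by
      intro i
      rw [f₁.2 5 (by decide)]
      simp only [σ₀, inputStore]
      cases L[i]? <;> rfl) (by
      intro i p hp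
      rw [f₁.2 0 (by decide), f₁.2 1 (by decide), f₁.2 2 (by decide)]
      simp only [σ₀, inputStore, hp]
      exact ⟨rfl, rfl, (weight_of_adj 𝒢 ((weight_pos_iff 𝒢).1
        ((hpos _ _).2 (Or.inl (List.mem_of_getElem? hp))))).symm⟩)
    (fun x y h1 h2 => by
      have := (hpos x y).not.2 (not_or.2 ⟨h1, h2⟩)
      omega) (by omega) (fun p hp => by
      have h1 := (weight_pos_iff 𝒢).1 ((hpos _ _).2 (Or.inl hp))
      have := hΛ s(p.1, p.2) h1
      rw [weight_of_adj 𝒢 h1]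
      omega)
  have f₂ := exec_frame e₂
  obtain ⟨t₃, σ₃, e₃, b₃, hσ₃, f₃⟩ :=
    (runs_of_fits (W := W) (assign 2 (.const 0)) σ₂ (by simp)).frame
  have harr (A : ℕ) (hA : A ≠ 5) : σ₃.arr A = σ₀.arr A := by
    rw [f₃.2 A (by simp [arrsOf, assign]), f₂.2 A (by simpa [arrsOf, matrixProg] using hA),
      f₁.2 A (by simp [arrsOf, assign])]
  have hzero (A i : ℕ) (hA : 5 < A) : σ₃.arr A i = 0 := by
    rw [harr A hA.ne']
    simp only [σ₀, inputStore]
    cases L[i]? with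
    | none => rfl
    | some p => simp [show A ≠ 0 by omega, show A ≠ 1 by omega, show A ≠ 2 by omega]
  have hP : Progress L.length (weight 𝒢) L ∅ 0 σ₃ := by
    refine ⟨?_, ?_, ?_, ?_, ?_, ?_, ?_, ?_, Nat.zero_le _, ⟨?_, ?_, ?_, ?_, ?_⟩,
      fun s => ⟨?_, ?_⟩, ?_⟩
    · rw [f₃.1 0 (by decide), f₂.1 0 (by decide), f₁.1 0 (by decide)]; rfl
    · rw [f₃.1 1 (by decide), f₂.1 1 (by decide), f₁.1 1 (by decide)]; rfl
    · simp [hσ₃]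
    · rw [f₃.1 7 (by decide), f₂.1 7 (by decide)]; simp [hσ₁]
    · rw [f₃.1 40 (by decide), f₂.1 40 (by decide)]; simp [hσ₁, σ₀, inputStore]
    · rw [f₃.2 5 (by decide)]; exact h₂
    · intro i p hp
      rw [harr 0 (by decide)]; simp [σ₀, inputStore, hp]
    · intro i p hp
      rw [harr 1 (by decide)]; simp [σ₀, inputStore, hp]
    · simp
    · simp
    · simp
    · simp
    · simp
    · simp
    · intro x y _
      rw [hzero _ _ (by cases s <;> simp [tarr])]
      omega
    · simp
  obtain ⟨t₄, σ₄, e₄, b₄, h₄⟩ := exec_mainLoop (weight_comm 𝒢) (weight_self 𝒢)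
    (fun R hR => hlen ▸ ncard_le_numEdges R hR) hpos hW hP
  obtain ⟨t₅, σ₅, e₅, b₅, hσ₅, f₅⟩ := (runs_of_fits (W := W) (assign 0 (.reg 7)) σ₄ (by
    rcases h₄ with h | h <;> simp [h.1]; omega)).frame
  have hreg : σ₅.reg 0 = σ₄.reg 7 := by simp [hσ₅]
  have hout : outputArcs n 𝒢.numEdges σ₅ = outputArcs n L.length σ₄ := by
    simp [outputArcs, hσ₅, hlen]
  have b₁' : t₁ ≤ 3 := b₁
  have b₃' : t₃ ≤ 1 := b₃
  have b₅' : t₅ ≤ 1 := b₅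
  cases e₁ with | seq a₁ a₂ => cases a₂ with | seq a₂ a₃ =>
  refine ⟨_, σ₅, .seq a₁ (.seq a₂ (.seq a₃ (.seq e₂ (.seq e₃ (.seq e₄ (.seq e₅ (.skip _))))))),
    by omega, ?_⟩
  rcases h₄ with ⟨h5, h6⟩ | ⟨h5, h6⟩
  · have h7 := (isTTO_iff_isSolution 𝒢 _).2 h6
    exact ⟨fun _ => ⟨hreg.trans h5, by rw [hout]; exact h7⟩, fun h => absurd ⟨_, h7⟩ h⟩
  · have h7 : ¬ 𝒢.IsTComparability := fun ⟨O, hO⟩ => h6 O ((isTTO_iff_isSolution 𝒢 O).1 hO)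
    exact ⟨fun h => absurd h h7, fun _ => hreg.trans h5⟩

/-- The numbers that occur fit into words of `O(log (n + Λ + 2))` bits. -/
theorem word_size (n Λ : ℕ) {C : ℕ} (hC : 4 ≤ C) :
    2 * (n * n) + n + 2 ≤ (n + Λ + 2) ^ C ∧ Λ + 1 ≤ (n + Λ + 2) ^ C := by
  have e : (n + Λ + 2) ^ 2 = n * n + Λ * Λ + 2 * (n * Λ) + 4 * n + 4 * Λ + 4 := by ring
  have h : 4 * (n + Λ + 2) ^ 2 ≤ (n + Λ + 2) ^ C := calc
    4 * (n + Λ + 2) ^ 2 ≤ (n + Λ + 2) ^ 2 * (n + Λ + 2) ^ 2 :=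
      Nat.mul_le_mul_right _ (by omega)
    _ = (n + Λ + 2) ^ 4 := by rw [← pow_add]
    _ ≤ (n + Λ + 2) ^ C := Nat.pow_le_pow_right (by omega) hC
  constructor <;> omega

end TemporalOrientation

theorem mainTheorem2 :
    ∃ (P : WordRAM.Program) (C : ℕ),
      ∀ (n : ℕ) (𝒢 : TemporalGraph (Fin n)) (L : List (Fin n × Fin n)) (Λ : ℕ),
        𝒢.IsEdgeList L →
        (∀ e ∈ 𝒢.graph.edgeSet, 𝒢.label e ≤ Λ) →
        ∃ (t : ℕ) (s : WordRAM.Store),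
          WordRAM.Exec ((n + Λ + 2) ^ C) P (𝒢.inputStore L) t s ∧
          t ≤ C * (max (n * 𝒢.numEdges)
            (min (𝒢.numMonolabelTriangles * n) (𝒢.numEdges ^ 2)) + 1) ∧
          𝒢.IsSolvedBy s := by
  -- `1100` serves as the factor of the running time and as the exponent of the word size
  refine ⟨TemporalOrientation.orientProg, 1100, fun n 𝒢 L Λ hL hΛ => ?_⟩
  have hlen := TemporalOrientation.length_eq_numEdges hL
  have hsq := TemporalOrientation.length_le_sq hL
  obtain ⟨hW, hΛW⟩ := TemporalOrientation.word_size n Λ (show 4 ≤ 1100 by norm_num)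
  obtain ⟨t, σ, h1, h2, h3⟩ := TemporalOrientation.exec_orientProg hL hΛ (by omega) hΛW
  refine ⟨t, σ, h1, h2.trans ?_, h3⟩
  have h4 : L.length ≤ n * L.length := by
    rcases L with _ | ⟨p, L⟩
    · simp
    · exact Nat.le_mul_of_pos_left _ p.1.pos
  rw [← hlen]
  have h5 := le_max_left (n * L.length) (min (𝒢.numMonolabelTriangles * n) (L.length ^ 2))
  omega
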